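/- **Setting.** A unit of the super-population $\mathbb P$ consists of covariates $X\in\mathbb R^d$, a treatment $A\in\{0,1\}$ and potential outcomes $Y(0),Y(1)$ with $\mathbb E|Y(a)|<\infty$; the observation is $Z=(A,X,Y)$ with $Y=AY(1)+(1-A)Y(0)$. Assume $(Y(0),Y(1))\perp A\mid X$. Let $e(X)=\mathbb P(A=1\mid X)$ and $\tau(X)=\mathbb E[Y(1)-Y(0)\mid X]$. Let $\hat\tau_1,\hat\tau_2:\mathbb R^d\to\mathbb R$ be fixed measurable functions (candidate CATE estimators, trained on an independent sample) with $\phi(\hat\tau_k)=\mathbb E[(\hat\tau_k(X)-\tau(X))^2]<\infty$, and let $\delta(\hat\tau_1,\hat\tau_2)=\phi(\hat\tau_1)-\phi(\hat\tau_2)$. Write $w=\hat\tau_1-\hat\tau_2$. Let $\Phi:\mathbb R^d\to\mathbb R^m$ be a fixed measurable representation with $\mathbb E\|\Phi(X)\|<\infty$. The working models are $$e(\Phi(x),\gamma)=\frac{\exp(\Phi(x)^\top\gamma)}{1+\exp(\Phi(x)^\top\gamma)},\qquad \mu_a(\Phi(x),\beta_a)=\Phi(x)^\top\beta_a\quad(a=0,1).$$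 For functions $\mu_0,\mu_1,e$ put $$\varphi(Z;\mu_0,\mu_1,e)=\hat\tau_1^2(X)-\hat\tau_2^2(X)-2w(X)\Big(\tfrac{A(Y-\mu_1(X))}{e(X)}+\mu_1(X)-\tfrac{(1-A)(Y-\mu_0(X))}{1-e(X)}-\mu_0(X)\Big).$$ **Estimators.** Let $Z_1,Z_2,\dots$ be the observations of i.i.d. units from $\mathbb P$. Fix $c\ge 0$. The estimators are random vectors $\check\gamma,\check\beta_0,\check\beta_1\in\mathbb R^m$ (depending on $n$) such that: 1. $\check\gamma$, with suitable $\xi,\eta\in\mathbb R^m$, minimizes, up to an error $o_{\mathbb P}(1)$, $$-\frac1n\sum_{i=1}^n\big[A_i\log e(\Phi(X_i),\gamma)+(1-A_i)\log(1-e(\Phi(X_i),\gamma))\big]+c\sum_{j=1}^m(\xi_j+\eta_j)$$ over all $(\gamma,\xi,\eta)$ with $\xi_j,\eta_j\ge0$ and, for all $j$, $$\Big|\frac1n\sum_{i=1}^n w(X_i)\Big(1-\tfrac{A_i}{e(\Phi(X_i),\gamma)}\Big)\Phi_j(X_i)\Big|\le\xi_j,\qquad \Big|\frac1n\sum_{i=1}^n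 w(X_i)\Big(1-\tfrac{1-A_i}{1-e(\Phi(X_i),\gamma)}\Big)\Phi_j(X_i)\Big|\le\eta_j;$$ the triple $(\check\gamma,\xi,\eta)$ itself satisfies these constraints; 2. $(\check\beta_0,\check\beta_1)$ is a critical point, up to an error $o_{\mathbb P}(1)$ in the derivative (in particular any minimizer qualifies), of the weighted least-squares loss, in which $\check e(x)=e(\Phi(x),\check\gamma)$: $$\mathcal L_{\rm wls}(\beta_0,\beta_1;\check\gamma)=\frac1n\sum_{i=1}^n w(X_i)\Big[\tfrac{(1-A_i)\,\check e(X_i)\,(Y_i-\Phi(X_i)^\top\beta_0)^2}{1-\check e(X_i)}+\tfrac{A_i(1-\check e(X_i))(Y_i-\Phi(X_i)^\top\beta_1)^2}{\check e(X_i)}\Big].$$ Let $\check\delta(\hat\tau_1,\hat\tau_2)=\frac1n\sum_{i=1}^n\varphi(Z_i;\check\mu_0,\check\mu_1,\check e)$, where $\check\mu_a(x)=\Phi(x)^\top\check\beta_a$. **Theorem 1.** Suppose that the propensity-score model is correctly specified, i.e. $e(X)=e(\Phi(X),\gamma^*)$ a.s. for some $\gamma^*\in\mathbb R^m$ (so that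 $0<e(X)<1$ a.s.), and that for some $\bar\gamma,\bar\beta_0,\bar\beta_1\in\mathbb R^m$ $$\check\gamma-\bar\gamma=o_{\mathbb P}(n^{-1/4}),\qquad \check\beta_0-\bar\beta_0=o_{\mathbb P}(n^{-1/4}),\qquad \check\beta_1-\bar\beta_1=o_{\mathbb P}(n^{-1/4}).$$ Put $\bar e(x)=e(\Phi(x),\bar\gamma)$ and $\bar\mu_a(x)=\Phi(x)^\top\bar\beta_a$. Assume the moment conditions $\mathbb E[\varphi(Z;\bar\mu_0,\bar\mu_1,\bar e)^2]<\infty$ and, for some $r>0$, $$\mathbb E\Big[w(X)^2\Big(\tfrac{A}{\bar e(X)}+\tfrac{1-A}{1-\bar e(X)}\Big)^2(1+|Y|+\|\Phi(X)\|)^2e^{2r\|\Phi(X)\|}\Big]<\infty.$$ Then, without any assumption that the outcome-regression model is correctly specified, $$\sqrt n\,\big(\check\delta(\hat\tau_1,\hat\tau_2)-\delta(\hat\tau_1,\hat\tau_2)\big)\xrightarrow{d}N(0,\sigma^2),\qquad \sigma^2=\operatorname{Var}\varphi(Z;\bar\mu_0,\bar\mu_1,\bar e).$$ -/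

import Mathlib

open MeasureTheory ProbabilityTheory Filter Topology

noncomputable section

namespace RelErr

/-- Euclidean space `ℝ^k`. -/
abbrev Vec (k : ℕ) : Type := EuclideanSpace ℝ (Fin k)

/-- A unit of the super-population: covariates `X ∈ ℝ^d`, binary treatment `A`
(`true` is treated, `false` is control), and the potential outcomes `Y(0)`, `Y(1)`. -/
abbrev PopUnit (d : ℕ) : Type := Vec d × Bool × ℝ × ℝ

/-- An observation `Z = (A, X, Y)`, with the treatment coded by `0` and `1`. -/
abbrev Obs (d : ℕ) : Type := ℝ × Vec d × ℝ

namespace PopUnit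

variable {d : ℕ}

/-- Covariates `X`. -/
def cov (u : PopUnit d) : Vec d := u.1

/-- Treatment `A ∈ {0, 1}` as a real number. -/
def treat (u : PopUnit d) : ℝ := if u.2.1 then 1 else 0

/-- Potential outcome `Y(0)`. -/
def y0 (u : PopUnit d) : ℝ := u.2.2.1

/-- Potential outcome `Y(1)`. -/
def y1 (u : PopUnit d) : ℝ := u.2.2.2

/-- Observed outcome `Y = A Y(1) + (1 - A) Y(0)`. -/
def outcome (u : PopUnit d) : ℝ := treat u * y1 u + (1 - treat u) * y0 u

/-- The observed part `Z = (A, X, Y)` of a unit. -/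
def obs (u : PopUnit d) : Obs d := (treat u, cov u, outcome u)

end PopUnit

section Population

variable {d : ℕ}

/-- The σ-algebra on the population generated by the covariates `X`. -/
abbrev sigmaX (d : ℕ) : MeasurableSpace (PopUnit d) :=
  MeasurableSpace.comap PopUnit.cov inferInstance

theorem sigmaX_le (d : ℕ) :
    sigmaX d ≤ (inferInstance : MeasurableSpace (PopUnit d)) :=
  Measurable.comap_le (measurable_fst : Measurable (fun u : PopUnit d => u.1))

/-- Unconfoundedness: `(Y(0), Y(1)) ⟂ A | X`. -/
def Unconfounded (pop : Measure (PopUnit d)) [IsFiniteMeasure pop] : Prop :=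
  CondIndepFun (sigmaX d) (sigmaX_le d)
    (fun u : PopUnit d => (PopUnit.y0 u, PopUnit.y1 u)) PopUnit.treat pop

/-- The propensity score `e(X) = P(A = 1 | X) = E[A | X]`. -/
def propensity (pop : Measure (PopUnit d)) : PopUnit d → ℝ :=
  pop[PopUnit.treat | sigmaX d]

/-- The conditional average treatment effect `τ(X) = E[Y(1) - Y(0) | X]`. -/
def cate (pop : Measure (PopUnit d)) : PopUnit d → ℝ :=
  pop[fun u => PopUnit.y1 u - PopUnit.y0 u | sigmaX d]

/-- The absolute error `φ(t) = E[(t(X) - τ(X))²]` of a candidate CATE estimator `t`. -/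
def absError (pop : Measure (PopUnit d)) (t : Vec d → ℝ) : ℝ :=
  ∫ u, (t (PopUnit.cov u) - cate pop u) ^ 2 ∂pop

/-- The relative error `δ(t₁, t₂) = φ(t₁) - φ(t₂)`. -/
def relError (pop : Measure (PopUnit d)) (t₁ t₂ : Vec d → ℝ) : ℝ :=
  absError pop t₁ - absError pop t₂

end Population

section Models

variable {d m : ℕ}

/-- The inner product `Φ(x)ᵀ b`. -/
def lin (Φ : Vec d → Vec m) (b : Vec m) (x : Vec d) : ℝ := ∑ j, Φ x j * b j

/-- The logistic propensity-score model `e(Φ(x), γ)`. -/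
def psModel (Φ : Vec d → Vec m) (γ : Vec m) (x : Vec d) : ℝ :=
  Real.exp (lin Φ γ x) / (1 + Real.exp (lin Φ γ x))

/-- The linear outcome-regression model `μ_a(Φ(x), β_a) = Φ(x)ᵀ β_a`. -/
def orModel (Φ : Vec d → Vec m) (β : Vec m) (x : Vec d) : ℝ := lin Φ β x

/-- The logistic propensity-score model is correctly specified: the true propensity score
belongs to the working model class. -/
def PSCorrect (pop : Measure (PopUnit d)) (Φ : Vec d → Vec m) : Prop :=
  ∃ γ : Vec m, propensity pop =ᵐ[pop] fun u => psModel Φ γ (PopUnit.cov u)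

/-- The function `φ(z; μ₀, μ₁, e)` at the observation `z = (a, x, y)`, for the candidate CATE
estimators `t₁` and `t₂`. -/
def phi (t₁ t₂ μ₀ μ₁ e : Vec d → ℝ) (z : Obs d) : ℝ :=
  let a := z.1
  let x := z.2.1
  let y := z.2.2
  (t₁ x ^ 2 - t₂ x ^ 2) - 2 * (t₁ x - t₂ x) *
    (a * (y - μ₁ x) / e x + μ₁ x - (1 - a) * (y - μ₀ x) / (1 - e x) - μ₀ x)

/-- `φ` with the working models plugged in: `φ(z; μ₀(Φ, β₀), μ₁(Φ, β₁), e(Φ, γ))`. -/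
def phiModel (t₁ t₂ : Vec d → ℝ) (Φ : Vec d → Vec m) (γ β₀ β₁ : Vec m) : Obs d → ℝ :=
  phi t₁ t₂ (orModel Φ β₀) (orModel Φ β₁) (psModel Φ γ)

/-- The inverse-probability weight `A / e(Φ(X), γ) + (1 - A) / (1 - e(Φ(X), γ))`. -/
def ipw (Φ : Vec d → Vec m) (γ : Vec m) (z : Obs d) : ℝ :=
  z.1 / psModel Φ γ z.2.1 + (1 - z.1) / (1 - psModel Φ γ z.2.1)

/-- The envelope `|t₁(X) - t₂(X)| W (1 + |Y| + ‖Φ(X)‖) exp(r ‖Φ(X)‖)`, with `W` the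
inverse-probability weight at `γ`. -/
def envelope (t₁ t₂ : Vec d → ℝ) (Φ : Vec d → Vec m) (γ : Vec m) (r : ℝ) (z : Obs d) : ℝ :=
  |t₁ z.2.1 - t₂ z.2.1| * ipw Φ γ z * (1 + |z.2.2| + ‖Φ z.2.1‖) * Real.exp (r * ‖Φ z.2.1‖)

end Models

section Sample

variable {d m : ℕ}

/-- Empirical mean `(1/n) ∑_{i<n} f(Z_i)`. -/
def empMean (n : ℕ) (z : ℕ → Obs d) (f : Obs d → ℝ) : ℝ :=
  (1 / (n : ℝ)) * ∑ i ∈ Finset.range n, f (z i)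

/-- The estimated relative error `(1/n) ∑ φ(Z_i; μ₀(Φ, β₀), μ₁(Φ, β₁), e(Φ, γ))`. -/
def relErrorEst (t₁ t₂ : Vec d → ℝ) (Φ : Vec d → Vec m) (n : ℕ) (z : ℕ → Obs d)
    (γ β₀ β₁ : Vec m) : ℝ :=
  empMean n z (phiModel t₁ t₂ Φ γ β₀ β₁)

/-- The weighted least-squares loss `L_wls(β₀, β₁; γ)`. -/
def wlsLoss (t₁ t₂ : Vec d → ℝ) (Φ : Vec d → Vec m) (n : ℕ) (z : ℕ → Obs d)
    (γ β₀ β₁ : Vec m) : ℝ :=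
  empMean n z fun o =>
    let a := o.1
    let x := o.2.1
    let y := o.2.2
    let e := psModel Φ γ x
    (t₁ x - t₂ x) *
      ((1 - a) * e * (y - lin Φ β₀ x) ^ 2 / (1 - e) + a * (1 - e) * (y - lin Φ β₁ x) ^ 2 / e)

/-- The cross-entropy loss of the propensity-score model. -/
def ceLoss (Φ : Vec d → Vec m) (n : ℕ) (z : ℕ → Obs d) (γ : Vec m) : ℝ :=
  -empMean n z fun o =>
    o.1 * Real.log (psModel Φ γ o.2.1) + (1 - o.1) * Real.log (1 - psModel Φ γ o.2.1)

/-- The balance constraints on `γ` and the slack variables `ξ`, `η`. -/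
structure BalanceFeasible (t₁ t₂ : Vec d → ℝ) (Φ : Vec d → Vec m) (n : ℕ) (z : ℕ → Obs d)
    (γ ξ η : Vec m) : Prop where
  treated : ∀ j, |empMean n z fun o =>
    (t₁ o.2.1 - t₂ o.2.1) * (1 - o.1 / psModel Φ γ o.2.1) * Φ o.2.1 j| ≤ ξ j
  control : ∀ j, |empMean n z fun o =>
    (t₁ o.2.1 - t₂ o.2.1) * (1 - (1 - o.1) / (1 - psModel Φ γ o.2.1)) * Φ o.2.1 j| ≤ η j
  slack_treated_nonneg : ∀ j, 0 ≤ ξ j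
  slack_control_nonneg : ∀ j, 0 ≤ η j

/-- The objective of the constrained problem: cross-entropy plus `c ∑ (ξ_j + η_j)`. -/
def balanceObjective (Φ : Vec d → Vec m) (c : ℝ) (n : ℕ) (z : ℕ → Obs d) (γ ξ η : Vec m) : ℝ :=
  ceLoss Φ n z γ + c * ∑ j, (ξ j + η j)

variable {Ω : Type*} [MeasurableSpace Ω]

/-- The estimators `γhat n`, together with some feasible slack variables, solve the constrained
problem up to an error that tends to `0` in probability. Exact solutions have error `0`; an error
is allowed because, with positive probability, an exact solution need not exist. -/
def SolvesBalance (P : Measure Ω) (t₁ t₂ : Vec d → ℝ) (Φ : Vec d → Vec m) (c : ℝ)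
    (Z : Ω → ℕ → Obs d) (γhat : ℕ → Ω → Vec m) : Prop :=
  ∃ (ξ η : ℕ → Ω → Vec m) (err : ℕ → Ω → ℝ),
    TendstoInMeasure P err atTop (fun _ => 0) ∧
    ∀ n ω, BalanceFeasible t₁ t₂ Φ n (Z ω) (γhat n ω) (ξ n ω) (η n ω) ∧
      ∀ γ' ξ' η' : Vec m, BalanceFeasible t₁ t₂ Φ n (Z ω) γ' ξ' η' →
        balanceObjective Φ c n (Z ω) (γhat n ω) (ξ n ω) (η n ω) ≤
          balanceObjective Φ c n (Z ω) γ' ξ' η' + err n ω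

/-- The estimators `(β₀hat n, β₁hat n)` solve the weighted least-squares problem at `γhat n`, up to
an error that tends to `0` in probability: the derivative of the loss `(β₀, β₁) ↦ L_wls(β₀, β₁; γ)`
vanishes asymptotically. At every exact minimizer the derivative is `0`; critical points are used
because the weights `t₁(X) - t₂(X)` may take both signs, and then there need not be a minimizer. -/
def SolvesWLS (P : Measure Ω) (t₁ t₂ : Vec d → ℝ) (Φ : Vec d → Vec m)
    (Z : Ω → ℕ → Obs d) (γhat β₀hat β₁hat : ℕ → Ω → Vec m) : Prop :=
  TendstoInMeasure P
    (fun n ω => fderiv ℝ (fun b : Vec m × Vec m => wlsLoss t₁ t₂ Φ n (Z ω) (γhat n ω) b.1 b.2)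
      (β₀hat n ω, β₁hat n ω))
    atTop (fun _ => 0)

/-- `b n` converges to `b₀` in probability at a rate faster than `n^{-1/4}`:
`b n - b₀ = o_P(n^{-1/4})`. -/
def FasterThanQuarterRate (P : Measure Ω) (b : ℕ → Ω → Vec m) (b₀ : Vec m) : Prop :=
  TendstoInMeasure P (fun (n : ℕ) ω => ((n : ℝ) ^ (1 / 4 : ℝ)) • (b n ω - b₀)) atTop (fun _ => 0)

end Sample

end RelErr

end

noncomputable section

namespace RelErr

/-! ### Finite sums of norms under convergence in probability. -/

section ConvergenceInMeasure

variable {Ω : Type*} [MeasurableSpace Ω] {P : Measure Ω}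

/-! The proof is a second-order expansion of `phiModel` in the nuisance parameters around their
limits. In the logistic model `1/e = 1 + exp(-Φᵀγ)` and `1/(1-e) = 1 + exp(Φᵀγ)`, so the derivative
in γ is twice the sum of `treatedScore` and `controlScore`, which are up to a factor the gradients
of the weighted least-squares loss. The derivative in the β's consists of `controlBalance` and
`treatedBalance`. If all these functions have mean zero at the limits, their empirical means are
`O_P(n^{-1/2})`, the linear term is `o_P(n^{-1/2})`, and the quadratic remainder is the square of
`o_P(n^{-1/4})` times a convergent mean of `envelope`. Hence estimating the nuisances costs nothing
at the scale `√n` (`tendstoInMeasure_sqrt_mul_relErrorEst_sub`).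

The means vanish for two different reasons (`nuisance_limits`). The scores have mean zero because
the estimated β's are approximate critical points; correctness of the outcome model plays no role.
The balance functions have mean zero because the limiting propensity score is the true one: at a
true parameter the imbalances, hence the penalty, tend to 0, so comparison with that parameter shows
that the limit γbar has at least the true expected log-likelihood, and Gibbs' inequality identifies
the propensity score. The parameter itself need not be identified.

With the true propensity score, inverse-probability weighting makes `phiModel` unbiased for the
relative error (`integral_phiModel_eq_relError`). The central limit theorem at the limits and
Slutsky's theorem finish the proof. -/

theorem tendstoInMeasure_norm_zero {E : Type*} [NormedAddCommGroup E]
    {X : ℕ → Ω → E} (hX : TendstoInMeasure P X atTop (fun _ => 0)) :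
    TendstoInMeasure P (fun n ω => ‖X n ω‖) atTop (fun _ => 0) := by
  rw [tendstoInMeasure_iff_norm] at hX ⊢
  simpa using hX

theorem tendstoInMeasure_add_norm {E F : Type*} [NormedAddCommGroup E]
    [NormedAddCommGroup F] {X : ℕ → Ω → E} {Y : ℕ → Ω → F}
    (hX : TendstoInMeasure P X atTop (fun _ => 0))
    (hY : TendstoInMeasure P Y atTop (fun _ => 0)) :
    TendstoInMeasure P (fun n ω => ‖X n ω‖ + ‖Y n ω‖) atTop (fun _ => 0) := by
  rw [tendstoInMeasure_iff_norm] at hX hY ⊢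
  intro ε hε
  have h := (hX (ε / 2) (by positivity)).add (hY (ε / 2) (by positivity))
  rw [add_zero] at h
  refine tendsto_of_tendsto_of_tendsto_of_le_of_le tendsto_const_nhds h (fun _ => zero_le) ?_
  intro n
  refine (measure_mono ?_).trans (measure_union_le _ _)
  intro ω hω
  simp only [Set.mem_ofPred_eq, Set.mem_union, sub_zero, Real.norm_eq_abs] at hω ⊢
  rw [abs_of_nonneg (by positivity)] at hω
  by_contra! hcon
  linarith [hcon.1, hcon.2]

theorem tendstoInMeasure_sum_norm {ι E : Type*} [NormedAddCommGroup E] (s : Finset ι)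
    {X : ι → ℕ → Ω → E} (hX : ∀ i, TendstoInMeasure P (X i) atTop (fun _ => 0)) :
    TendstoInMeasure P (fun n ω => ∑ i ∈ s, ‖X i n ω‖) atTop (fun _ => 0) := by
  classical
  induction s using Finset.induction_on with
  | empty =>
    rw [tendstoInMeasure_iff_norm]
    intro ε hε
    simp [hε.not_ge]
  | insert a s ha ih =>
    refine (tendstoInMeasure_add_norm (hX a) ih).congr_left fun n => ae_of_all _ fun ω => ?_
    beta_reduce
    rw [Finset.sum_insert ha]
    congr 1
    exact Real.norm_of_nonneg (by positivity)

end ConvergenceInMeasure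

/-! ### Law of large numbers, Chebyshev rate and central limit theorem for i.i.d. samples. -/

section IID

variable {Ω S : Type*} [MeasurableSpace Ω] [MeasurableSpace S] {P : Measure Ω}
  {μ : Measure S} {U : ℕ → Ω → S} {f : S → ℝ}

theorem ae_tendsto_mean (hU : ∀ i, HasLaw (U i) μ P) (hindep : iIndepFun U P)
    (hf : Measurable f) (hint : Integrable f μ) :
    ∀ᵐ ω ∂P, Tendsto (fun n : ℕ => (1 / (n : ℝ)) * ∑ i ∈ Finset.range n, f (U i ω)) atTop
      (𝓝 (∫ u, f u ∂μ)) := by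
  have hint0 : Integrable (f ∘ U 0) P := by
    rw [← (hU 0).map_eq] at hint
    exact hint.comp_aemeasurable (hU 0).aemeasurable
  have h := strong_law_ae_real (μ := P) (fun i => f ∘ U i) hint0
    (fun i j hij => (hindep.indepFun hij).comp hf hf)
    (fun i => ((hU i).identDistrib (hU 0)).comp hf)
  rw [(hU 0).integral_comp hint.aestronglyMeasurable] at h
  filter_upwards [h] with ω hω
  refine hω.congr fun n => ?_
  simp only [Function.comp]
  ring

theorem memLp_comp_of_hasLaw {V : Ω → S} (hV : HasLaw V μ P) (hmem : MemLp f 2 μ) :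
    MemLp (f ∘ V) 2 P := by
  rw [← hV.map_eq] at hmem
  exact hmem.comp_of_map hV.aemeasurable

variable [IsProbabilityMeasure P]

/-- By Chebyshev: the scaled mean has variance `V n^{-1/2}`. The exponent 1/4 falls short of the
true rate, but it is enough, since such means are only ever multiplied by parameter errors that are
themselves `o_P(n^{-1/4})`. -/
theorem tendstoInMeasure_rpow_mul_mean (hU : ∀ i, HasLaw (U i) μ P) (hindep : iIndepFun U P)
    (hf : Measurable f) (hmem : MemLp f 2 μ) (hmean : ∫ u, f u ∂μ = 0) :
    TendstoInMeasure P (fun (n : ℕ) ω =>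
      (n : ℝ) ^ (1 / 4 : ℝ) * ((1 / (n : ℝ)) * ∑ i ∈ Finset.range n, f (U i ω)))
      atTop (fun _ => 0) := by
  have hmem' : ∀ i, MemLp (f ∘ U i) 2 P := fun i => memLp_comp_of_hasLaw (hU i) hmem
  have hvar : ∀ i, variance (f ∘ U i) P = variance (f ∘ U 0) P := fun i =>
    (((hU i).identDistrib (hU 0)).comp hf).variance_eq
  have hmean' : ∀ i, ∫ ω, f (U i ω) ∂P = 0 := fun i => by
    rw [← hmean, ← (hU i).integral_comp hmem.aestronglyMeasurable]
    rfl
  set V := variance (f ∘ U 0) P with hV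
  rw [tendstoInMeasure_iff_norm]
  intro ε hε
  have hlim : Tendsto (fun n : ℕ => ENNReal.ofReal (V / ε ^ 2 * (n : ℝ) ^ (-(1 / 2) : ℝ)))
      atTop (𝓝 0) := by
    have h := ((tendsto_rpow_neg_atTop (y := 1 / 2) (by norm_num)).comp
      (tendsto_natCast_atTop_atTop (R := ℝ))).const_mul (V / ε ^ 2)
    rw [mul_zero] at h
    simpa using ENNReal.tendsto_ofReal h
  refine tendsto_of_tendsto_of_tendsto_of_le_of_le' tendsto_const_nhds hlim
    (Eventually.of_forall fun _ => zero_le) ?_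
  filter_upwards [eventually_gt_atTop 0] with n hn
  have hn' : (0 : ℝ) < n := by exact_mod_cast hn
  set a : ℝ := (n : ℝ) ^ (1 / 4 : ℝ) * (1 / (n : ℝ)) with ha
  have hsum : MemLp (∑ i ∈ Finset.range n, f ∘ U i) 2 P :=
    memLp_finsetSum' _ fun i _ => hmem' i
  have hX : MemLp (a • ∑ i ∈ Finset.range n, f ∘ U i) 2 P := hsum.const_smul a
  have hEX : P[a • ∑ i ∈ Finset.range n, f ∘ U i] = 0 := by
    simp only [Pi.smul_apply, Finset.sum_apply, Function.comp, smul_eq_mul]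
    rw [integral_const_mul, integral_finsetSum (f := fun i ω => f (U i ω)) _
      fun i _ => (hmem' i).integrable one_le_two]
    simp [hmean']
  have hVX : variance (a • ∑ i ∈ Finset.range n, f ∘ U i) P
      = V * (n : ℝ) ^ (-(1 / 2) : ℝ) := by
    rw [variance_smul, IndepFun.variance_sum (fun i _ => hmem' i)
      (fun i _ j _ hij => (hindep.indepFun hij).comp hf hf)]
    simp only [hvar, Finset.sum_const, Finset.card_range, nsmul_eq_mul]
    have h4 : ((n : ℝ) ^ (1 / 4 : ℝ)) ^ 2 = (n : ℝ) ^ (1 / 2 : ℝ) := by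
      rw [← Real.rpow_natCast, ← Real.rpow_mul hn'.le]
      norm_num
    have h5 : (n : ℝ) ^ (-(1 / 2) : ℝ) = (n : ℝ) ^ (1 / 2 : ℝ) / n := by
      rw [eq_div_iff hn'.ne', ← Real.rpow_add_one hn'.ne']
      norm_num
    rw [ha, mul_pow, h4, h5]
    field_simp
  have hcheb := meas_ge_le_variance_div_sq hX hε
  rw [hEX, hVX] at hcheb
  refine (measure_mono fun ω hω => ?_).trans (hcheb.trans_eq ?_)
  · simp only [Set.mem_ofPred_eq, sub_zero, Real.norm_eq_abs] at hω
    simpa [ha, mul_assoc] using hω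
  · congr 1
    ring

theorem tendstoInDistribution_sqrt_mul_mean_sub (hU : ∀ i, HasLaw (U i) μ P)
    (hindep : iIndepFun U P) (hf : Measurable f) (hmem : MemLp f 2 μ) :
    TendstoInDistribution
      (fun (n : ℕ) ω => Real.sqrt n *
        ((1 / (n : ℝ)) * ∑ i ∈ Finset.range n, f (U i ω) - ∫ u, f u ∂μ))
      atTop (id : ℝ → ℝ) (fun _ => P) (gaussianReal 0 (Real.toNNReal (variance f μ))) := by
  have hvar : variance (f ∘ U 0) P = variance f μ :=
    IdentDistrib.variance_eq ⟨(hf.comp_aemeasurable (hU 0).aemeasurable), hf.aemeasurable, by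
      rw [← AEMeasurable.map_map_of_aemeasurable hf.aemeasurable (hU 0).aemeasurable,
        (hU 0).map_eq]⟩
  have hmean : ∫ ω, (f ∘ U 0) ω ∂P = ∫ u, f u ∂μ :=
    (hU 0).integral_comp hmem.aestronglyMeasurable
  have hlaw : HasLaw (id : ℝ → ℝ) (gaussianReal 0 (Real.toNNReal (variance (f ∘ U 0) P)))
      (gaussianReal 0 (Real.toNNReal (variance f μ))) := by
    rw [hvar]; exact HasLaw.id
  have h := tendstoInDistribution_inv_sqrt_mul_sum_sub (X := fun i => f ∘ U i) hlaw
    (memLp_comp_of_hasLaw (hU 0) hmem)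
    (hindep.comp (fun _ => f) fun _ => hf)
    (fun i => ((hU i).identDistrib (hU 0)).comp hf)
  refine h.congr (fun n => ae_of_all _ fun ω => ?_) EventuallyEq.rfl
  rw [hmean]
  rcases Nat.eq_zero_or_pos n with rfl | hn
  · simp
  have hn' : (0 : ℝ) < n := by exact_mod_cast hn
  have hs : (Real.sqrt n)⁻¹ = Real.sqrt n / n := by
    rw [Real.sqrt_div_self]
  simp only [Function.comp]
  rw [hs]
  field_simp

end IID

/-! ### Conditional independence as an identity of weighted joint laws. -/

section CondIndep

variable {Ω β γ δ : Type*} {m' mΩ : MeasurableSpace Ω} [StandardBorelSpace Ω]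
  [MeasurableSpace β] [MeasurableSpace γ] [MeasurableSpace δ]
  {hm' : m' ≤ mΩ} {μ : Measure Ω} [IsFiniteMeasure μ] {f : Ω → β} {g : Ω → γ}

/-- If `f` and `g` are conditionally independent given `m'`, then restricting to `{g ∈ T}` has the
same effect on the joint law of `f` and an `m'`-measurable variable as weighting by the conditional
probability of `{g ∈ T}`. -/
theorem map_restrict_eq_map_withDensity (hf : Measurable f) (hg : Measurable g)
    (h : CondIndepFun m' hm' f g μ) {X : Ω → δ} (hX : Measurable[m'] X) {T : Set γ}
    (hT : MeasurableSet T) {q : Ω → ℝ} (hq : q =ᵐ[μ] μ⟦g ⁻¹' T | m'⟧) :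
    (μ.restrict (g ⁻¹' T)).map (fun ω => (X ω, f ω)) =
      (μ.withDensity fun ω => ENNReal.ofReal (q ω)).map (fun ω => (X ω, f ω)) := by
  have hXm : Measurable X := hX.mono hm' le_rfl
  have hXf : Measurable fun ω => (X ω, f ω) := hXm.prodMk hf
  have hqint : Integrable q μ := integrable_condExp.congr hq.symm
  have hq0 : 0 ≤ᵐ[μ] q := by
    have : 0 ≤ᵐ[μ] μ⟦g ⁻¹' T | m'⟧ :=
      condExp_nonneg (ae_of_all _ fun ω => Set.indicator_nonneg (fun _ _ => zero_le_one) ω)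
    filter_upwards [hq, this] with ω h1 h2
    rw [h1]; exact h2
  have : IsFiniteMeasure (μ.withDensity fun ω => ENNReal.ofReal (q ω)) :=
    isFiniteMeasure_withDensity_ofReal hqint.2
  -- Both measures are finite, so agreement on rectangles is enough.
  refine Measure.ext_prod fun {S B} hS hB => ?_
  have hSm : MeasurableSet[m'] (X ⁻¹' S) := hX hS
  have hSΩ : MeasurableSet (X ⁻¹' S) := hXm hS
  have hBΩ : MeasurableSet (f ⁻¹' B) := hf hB
  have hTΩ : MeasurableSet (g ⁻¹' T) := hg hT
  rw [Measure.map_apply hXf (hS.prod hB), Measure.map_apply hXf (hS.prod hB)]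
  have hpre : (fun ω => (X ω, f ω)) ⁻¹' (S ×ˢ B) = X ⁻¹' S ∩ f ⁻¹' B := rfl
  rw [hpre, Measure.restrict_apply (hSΩ.inter hBΩ), withDensity_apply _ (hSΩ.inter hBΩ),
    ← ofReal_integral_eq_lintegral_ofReal hqint.integrableOn (ae_restrict_of_ae hq0)]
  have hone : Integrable (fun _ : Ω => (1 : ℝ)) μ := integrable_const 1
  have hbound : Integrable ((f ⁻¹' B).indicator (fun _ => (1 : ℝ)) * q) μ := by
    have : (f ⁻¹' B).indicator (fun _ => (1 : ℝ)) * q = (f ⁻¹' B).indicator q := by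
      ext ω
      by_cases hω : ω ∈ f ⁻¹' B <;> simp [hω]
    rw [this]
    exact hqint.indicator hBΩ
  have hind := (condIndepFun_iff_condExp_inter_preimage_eq_mul hf hg).1 h B T hB hT
  -- `q` is only a.e. equal to an `m'`-measurable function; that already allows it to be pulled out.
  have hpull : μ[(f ⁻¹' B).indicator (fun _ => (1 : ℝ)) * q | m'] =ᵐ[μ]
      μ⟦f ⁻¹' B | m'⟧ * q :=
    condExp_mul_of_aestronglyMeasurable_right
      (stronglyMeasurable_condExp.aestronglyMeasurable.congr hq.symm) hbound
      (hone.indicator hBΩ)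
  -- Both integrands have the same conditional expectation given `m'`, by the product formula for
  -- conditional independence, and `X ⁻¹' S` lies in `m'`.
  have hkey : ∫ ω in X ⁻¹' S, (f ⁻¹' B ∩ g ⁻¹' T).indicator (fun _ => (1 : ℝ)) ω ∂μ =
      ∫ ω in X ⁻¹' S, ((f ⁻¹' B).indicator (fun _ => (1 : ℝ)) * q) ω ∂μ := by
    rw [← setIntegral_condExp hm' (hone.indicator (hBΩ.inter hTΩ)) hSm,
      ← setIntegral_condExp hm' hbound hSm]
    refine setIntegral_congr_ae hSΩ ?_
    filter_upwards [hind, hpull, hq] with ω h1 h2 h3 _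
    rw [h1, h2, Pi.mul_apply, h3]
  have hright : ∫ ω in X ⁻¹' S, ((f ⁻¹' B).indicator (fun _ => (1 : ℝ)) * q) ω ∂μ =
      ∫ ω in X ⁻¹' S ∩ f ⁻¹' B, q ω ∂μ := by
    rw [← setIntegral_indicator hBΩ]
    refine setIntegral_congr_fun hSΩ fun ω _ => ?_
    by_cases hω : ω ∈ f ⁻¹' B <;> simp [hω]
  rw [← hright, ← hkey, setIntegral_indicator (hBΩ.inter hTΩ), setIntegral_const, smul_eq_mul,
    mul_one, Measure.real, ENNReal.ofReal_toReal (measure_ne_top _ _), Set.inter_assoc]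

end CondIndep

/-! ### Replacing the treatment by its propensity score under the integral. -/

section Population

variable {d : ℕ} {pop : Measure (PopUnit d)} [IsProbabilityMeasure pop]

theorem measurable_cov : Measurable (PopUnit.cov : PopUnit d → Vec d) := measurable_fst

theorem measurable_treat : Measurable (PopUnit.treat : PopUnit d → ℝ) := by
  unfold PopUnit.treat
  exact (measurable_from_top (f := fun b : Bool => if b then (1 : ℝ) else 0)).comp
    (measurable_fst.comp measurable_snd)

theorem measurable_y0 : Measurable (PopUnit.y0 : PopUnit d → ℝ) :=
  measurable_fst.comp (measurable_snd.comp measurable_snd)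

theorem measurable_y1 : Measurable (PopUnit.y1 : PopUnit d → ℝ) :=
  measurable_snd.comp (measurable_snd.comp measurable_snd)

theorem measurable_outcome : Measurable (PopUnit.outcome : PopUnit d → ℝ) := by
  unfold PopUnit.outcome
  exact (measurable_treat.mul measurable_y1).add
    ((measurable_const.sub measurable_treat).mul measurable_y0)

theorem measurable_obs : Measurable (PopUnit.obs : PopUnit d → Obs d) :=
  measurable_treat.prodMk (measurable_cov.prodMk measurable_outcome)

theorem treat_eq (u : PopUnit d) : PopUnit.treat u = 0 ∨ PopUnit.treat u = 1 := by
  unfold PopUnit.treat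
  split <;> simp

theorem measurable_sigmaX_cov : Measurable[sigmaX d] (PopUnit.cov : PopUnit d → Vec d) :=
  Measurable.of_comap_le le_rfl

theorem integrable_treat : Integrable (PopUnit.treat : PopUnit d → ℝ) pop := by
  refine Integrable.of_bound measurable_treat.aestronglyMeasurable 1 (ae_of_all _ fun u => ?_)
  rcases treat_eq u with h | h <;> simp [h]

theorem treat_eq_indicator :
    (PopUnit.treat : PopUnit d → ℝ) = (PopUnit.treat ⁻¹' {1}).indicator (fun _ => 1) := by
  ext u
  rcases treat_eq u with h | h <;> simp [h]

theorem one_sub_treat_eq_indicator :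
    (fun u : PopUnit d => 1 - PopUnit.treat u) =
      (PopUnit.treat ⁻¹' {0}).indicator (fun _ => 1) := by
  ext u
  rcases treat_eq u with h | h <;> simp [h]

variable {p : Vec d → ℝ} {F : Vec d × ℝ × ℝ → ℝ}

/-- Both claims are read off from the equality of the two image laws. `F` may involve both potential
outcomes, which is where unconfoundedness is used. Integrability is an equivalence because it is
later transferred in both directions. -/
theorem integral_indicator_eq_of_condIndep (h_unconf : Unconfounded pop) (hp : Measurable p)
    (hp0 : ∀ x, 0 ≤ p x) {T : Set ℝ} (hT : MeasurableSet T)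
    (hps : (fun u : PopUnit d => p (PopUnit.cov u)) =ᵐ[pop]
      pop⟦PopUnit.treat ⁻¹' T | sigmaX d⟧) (hF : Measurable F) :
    (Integrable (fun u => (PopUnit.treat ⁻¹' T).indicator (fun _ => (1 : ℝ)) u *
        F (PopUnit.cov u, PopUnit.y0 u, PopUnit.y1 u)) pop ↔
      Integrable (fun u => p (PopUnit.cov u) *
        F (PopUnit.cov u, PopUnit.y0 u, PopUnit.y1 u)) pop) ∧
    ∫ u, (PopUnit.treat ⁻¹' T).indicator (fun _ => (1 : ℝ)) u *
        F (PopUnit.cov u, PopUnit.y0 u, PopUnit.y1 u) ∂pop =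
      ∫ u, p (PopUnit.cov u) * F (PopUnit.cov u, PopUnit.y0 u, PopUnit.y1 u) ∂pop := by
  have hmap := map_restrict_eq_map_withDensity (measurable_y0.prodMk measurable_y1)
    measurable_treat h_unconf measurable_sigmaX_cov hT hps
  have hmeas : Measurable fun u : PopUnit d => (PopUnit.cov u, PopUnit.y0 u, PopUnit.y1 u) :=
    measurable_cov.prodMk (measurable_y0.prodMk measurable_y1)
  have hTm : MeasurableSet ((PopUnit.treat : PopUnit d → ℝ) ⁻¹' T) := measurable_treat hT
  have hind : (fun u => (PopUnit.treat ⁻¹' T).indicator (fun _ => (1 : ℝ)) u *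
        F (PopUnit.cov u, PopUnit.y0 u, PopUnit.y1 u)) =
      (PopUnit.treat ⁻¹' T).indicator
        (fun u => F (PopUnit.cov u, PopUnit.y0 u, PopUnit.y1 u)) := by
    ext u
    by_cases hu : u ∈ PopUnit.treat ⁻¹' T
    · rw [Set.indicator_of_mem hu, Set.indicator_of_mem hu, one_mul]
    · rw [Set.indicator_of_notMem hu, Set.indicator_of_notMem hu, zero_mul]
  have hpc : Measurable fun u : PopUnit d => ENNReal.ofReal (p (PopUnit.cov u)) :=
    (hp.comp measurable_cov).ennreal_ofReal
  have hfin : ∀ᵐ u ∂pop, ENNReal.ofReal (p (PopUnit.cov u)) < ⊤ :=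
    ae_of_all _ fun _ => ENNReal.ofReal_lt_top
  have htr : ∀ u : PopUnit d, (ENNReal.ofReal (p (PopUnit.cov u))).toReal = p (PopUnit.cov u) :=
    fun u => ENNReal.toReal_ofReal (hp0 _)
  constructor
  · rw [hind, integrable_indicator_iff hTm, IntegrableOn]
    have h1 := integrable_map_measure (μ := pop.restrict (PopUnit.treat ⁻¹' T))
      hF.aestronglyMeasurable hmeas.aemeasurable
    have h2 := integrable_map_measure
      (μ := pop.withDensity fun u => ENNReal.ofReal (p (PopUnit.cov u)))
      hF.aestronglyMeasurable hmeas.aemeasurable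
    rw [hmap, h2] at h1
    rw [Function.comp_def] at h1
    rw [← h1, integrable_withDensity_iff_integrable_smul' hpc hfin]
    simp only [htr, smul_eq_mul]
  · rw [hind, integral_indicator hTm]
    have h1 := integral_map (μ := pop.restrict (PopUnit.treat ⁻¹' T)) hmeas.aemeasurable
      hF.aestronglyMeasurable
    have h2 := integral_map (μ := pop.withDensity fun u => ENNReal.ofReal (p (PopUnit.cov u)))
      hmeas.aemeasurable hF.aestronglyMeasurable
    rw [← h1, hmap, h2, integral_withDensity_eq_integral_toReal_smul hpc hfin]
    simp only [htr, smul_eq_mul]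

theorem integral_treat_mul (h_unconf : Unconfounded pop) (hp : Measurable p)
    (hp0 : ∀ x, 0 ≤ p x) (hps : propensity pop =ᵐ[pop] fun u => p (PopUnit.cov u))
    (hF : Measurable F) :
    (Integrable (fun u => PopUnit.treat u *
        F (PopUnit.cov u, PopUnit.y0 u, PopUnit.y1 u)) pop ↔
      Integrable (fun u => p (PopUnit.cov u) *
        F (PopUnit.cov u, PopUnit.y0 u, PopUnit.y1 u)) pop) ∧
    ∫ u, PopUnit.treat u * F (PopUnit.cov u, PopUnit.y0 u, PopUnit.y1 u) ∂pop =
      ∫ u, p (PopUnit.cov u) * F (PopUnit.cov u, PopUnit.y0 u, PopUnit.y1 u) ∂pop := by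
  have h := integral_indicator_eq_of_condIndep h_unconf hp hp0 (measurableSet_singleton 1)
    (by rw [← treat_eq_indicator]; exact hps.symm) hF
  rwa [← treat_eq_indicator] at h

theorem integral_one_sub_treat_mul (h_unconf : Unconfounded pop) (hp : Measurable p)
    (hp1 : ∀ x, p x ≤ 1) (hps : propensity pop =ᵐ[pop] fun u => p (PopUnit.cov u))
    (hF : Measurable F) :
    (Integrable (fun u => (1 - PopUnit.treat u) *
        F (PopUnit.cov u, PopUnit.y0 u, PopUnit.y1 u)) pop ↔
      Integrable (fun u => (1 - p (PopUnit.cov u)) *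
        F (PopUnit.cov u, PopUnit.y0 u, PopUnit.y1 u)) pop) ∧
    ∫ u, (1 - PopUnit.treat u) * F (PopUnit.cov u, PopUnit.y0 u, PopUnit.y1 u) ∂pop =
      ∫ u, (1 - p (PopUnit.cov u)) * F (PopUnit.cov u, PopUnit.y0 u, PopUnit.y1 u) ∂pop := by
  have hcond : pop⟦(PopUnit.treat : PopUnit d → ℝ) ⁻¹' {0} | sigmaX d⟧ =ᵐ[pop]
      fun u => 1 - p (PopUnit.cov u) := by
    rw [← one_sub_treat_eq_indicator]
    have h1 : pop[fun u => 1 - PopUnit.treat u | sigmaX d] =ᵐ[pop]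
        pop[fun _ => (1 : ℝ) | sigmaX d] - pop[PopUnit.treat | sigmaX d] :=
      condExp_sub (integrable_const 1) integrable_treat _
    rw [condExp_const (sigmaX_le d)] at h1
    filter_upwards [h1, hps] with u h2 h3
    rw [h2, Pi.sub_apply]
    congr 1
  have h := integral_indicator_eq_of_condIndep (p := fun x => 1 - p x) h_unconf
    (measurable_const.sub hp) (fun x => sub_nonneg.2 (hp1 x)) (measurableSet_singleton 0)
    hcond.symm hF
  have e : ∀ u : PopUnit d, (PopUnit.treat ⁻¹' {0}).indicator (fun _ => (1 : ℝ)) u =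
      1 - PopUnit.treat u := fun u => (congrFun one_sub_treat_eq_indicator u).symm
  simpa only [e] using h

end Population

/-! ### Elementary inequalities for the exponential, the softplus function and the Bernoulli
entropy. -/

section Scalar

theorem abs_exp_sub_one_le_abs_mul_exp (h : ℝ) : |Real.exp h - 1| ≤ |h| * Real.exp |h| := by
  have := Complex.norm_exp_sub_sum_le_norm_mul_exp (h : ℂ) 1
  simp only [Finset.range_one, Finset.sum_singleton, pow_zero, Nat.factorial_zero, Nat.cast_one,
    div_one, pow_one, Complex.norm_real, Real.norm_eq_abs] at this
  rwa [← Complex.ofReal_exp, ← Complex.ofReal_one, ← Complex.ofReal_sub, Complex.norm_real] at this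

theorem abs_exp_sub_one_sub_le_sq_mul_exp (h : ℝ) :
    |Real.exp h - 1 - h| ≤ h ^ 2 * Real.exp |h| := by
  have := Complex.norm_exp_sub_sum_le_norm_mul_exp (h : ℂ) 2
  simp only [Finset.sum_range_succ, Finset.range_zero, Finset.sum_empty, zero_add, pow_zero,
    Nat.factorial_zero, Nat.cast_one, div_one, pow_one, Nat.factorial_one, Complex.norm_real,
    Real.norm_eq_abs, sq_abs] at this
  rwa [← Complex.ofReal_exp, ← Complex.ofReal_one, ← Complex.ofReal_add, ← Complex.ofReal_sub,
    Complex.norm_real, Real.norm_eq_abs, ← sub_sub] at this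

/-- Half of the exponential rate absorbs the polynomial. With `x = r t / 2`, the bounds `x ≤ exp x`
and `x² / 2 ≤ exp x` give the constants `2 / r` and `8 / r ^ 2`. The other half is kept for
parameter shifts of norm at most `r / 2`. -/
theorem one_add_add_sq_mul_exp_le {r : ℝ} (hr : 0 < r) {t : ℝ} (ht : 0 ≤ t) :
    (1 + t + t ^ 2) * Real.exp (r / 2 * t) ≤ (1 + 2 / r + 8 / r ^ 2) * Real.exp (r * t) := by
  have hx : 0 ≤ r / 2 * t := by positivity
  have h0 : 1 ≤ Real.exp (r / 2 * t) := Real.one_le_exp hx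
  have h1 : t ≤ 2 / r * Real.exp (r / 2 * t) := by
    have := Real.add_one_le_exp (r / 2 * t)
    rw [div_mul_eq_mul_div, le_div_iff₀ hr]
    linarith
  have h2 : t ^ 2 ≤ 8 / r ^ 2 * Real.exp (r / 2 * t) := by
    have := Real.quadratic_le_exp_of_nonneg hx
    rw [div_mul_eq_mul_div, le_div_iff₀ (by positivity)]
    nlinarith
  have h3 : Real.exp (r * t) = Real.exp (r / 2 * t) * Real.exp (r / 2 * t) := by
    rw [← Real.exp_add]; ring_nf
  rw [h3, ← mul_assoc]
  refine mul_le_mul_of_nonneg_right ?_ (Real.exp_pos _).le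
  linarith

/-- Softplus is 1-Lipschitz since `1 + exp u ≤ exp |u - v| * (1 + exp v)`. -/
theorem abs_log_one_add_exp_sub_le (u v : ℝ) :
    |Real.log (1 + Real.exp u) - Real.log (1 + Real.exp v)| ≤ |u - v| := by
  have key : ∀ u v : ℝ, Real.log (1 + Real.exp u) ≤ |u - v| + Real.log (1 + Real.exp v) := by
    intro u v
    rw [← Real.log_exp |u - v|, ← Real.log_mul (Real.exp_pos _).ne' (by positivity)]
    refine Real.log_le_log (by positivity) ?_
    have h1 : 1 ≤ Real.exp |u - v| := Real.one_le_exp (abs_nonneg _)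
    have h2 : Real.exp u ≤ Real.exp |u - v| * Real.exp v := by
      rw [← Real.exp_add]
      exact Real.exp_le_exp.2 (by linarith [le_abs_self (u - v)])
    linarith
  rw [abs_sub_le_iff]
  constructor
  · linarith [key u v]
  · have := key v u
    rw [abs_sub_comm] at this
    linarith

theorem abs_log_one_add_exp_le (u : ℝ) : |Real.log (1 + Real.exp u)| ≤ 1 + |u| := by
  have h := abs_log_one_add_exp_sub_le u 0
  have h2 : |Real.log (1 + Real.exp 0)| ≤ 1 := by
    rw [Real.exp_zero, abs_of_nonneg (Real.log_nonneg (by norm_num))]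
    have := Real.log_two_lt_d9
    norm_num
    linarith
  rw [sub_zero] at h
  have := abs_sub_abs_le_abs_sub (Real.log (1 + Real.exp u)) (Real.log (1 + Real.exp 0))
  linarith

/-- Gibbs' inequality for two Bernoulli distributions. -/
theorem bernoulli_gibbs {p q : ℝ} (hp : 0 < p) (hp1 : p < 1) (hq : 0 < q) (hq1 : q < 1) :
    p * Real.log q + (1 - p) * Real.log (1 - q) ≤
        p * Real.log p + (1 - p) * Real.log (1 - p) ∧
      (p * Real.log q + (1 - p) * Real.log (1 - q) =
        p * Real.log p + (1 - p) * Real.log (1 - p) → q = p) := by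
  have e1 : Real.log q = Real.log (q / p) + Real.log p := by
    rw [Real.log_div hq.ne' hp.ne']; ring
  have e2 : Real.log (1 - q) = Real.log ((1 - q) / (1 - p)) + Real.log (1 - p) := by
    rw [Real.log_div (by linarith) (by linarith)]; ring
  have hp' : 0 < 1 - p := by linarith
  have hq' : 0 < 1 - q := by linarith
  have l1 : p * Real.log (q / p) ≤ q - p := by
    have := Real.log_le_sub_one_of_pos (div_pos hq hp)
    calc p * Real.log (q / p) ≤ p * (q / p - 1) := by gcongr
      _ = q - p := by field_simp
  have l2 : (1 - p) * Real.log ((1 - q) / (1 - p)) ≤ p - q := by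
    have := Real.log_le_sub_one_of_pos (div_pos hq' hp')
    calc (1 - p) * Real.log ((1 - q) / (1 - p)) ≤ (1 - p) * ((1 - q) / (1 - p) - 1) := by gcongr
      _ = p - q := by field_simp; ring
  rw [e1, e2]
  refine ⟨by linarith, fun h => ?_⟩
  by_contra hne
  have hne' : q / p ≠ 1 := by
    rwa [Ne, div_eq_one_iff_eq hp.ne']
  -- Strictness in one of the two logarithmic bounds already contradicts equality of the sums.
  have := Real.log_lt_sub_one_of_pos (div_pos hq hp) hne'
  have : p * Real.log (q / p) < q - p := by
    calc p * Real.log (q / p) < p * (q / p - 1) := by gcongr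
      _ = q - p := by field_simp
  linarith

end Scalar

/-! ### The logistic and linear working models: envelopes, increments and Taylor remainder. -/

section Models

variable {d m : ℕ} (Φ : Vec d → Vec m)

theorem lin_sub (b b' : Vec m) (x : Vec d) : lin Φ (b - b') x = lin Φ b x - lin Φ b' x := by
  simp [lin, mul_sub]

theorem abs_lin_le (b : Vec m) (x : Vec d) : |lin Φ b x| ≤ ‖Φ x‖ * ‖b‖ := by
  have h : lin Φ b x = inner ℝ b (Φ x) := by
    simp [lin, PiLp.inner_apply]
  rw [h, mul_comm]
  exact abs_real_inner_le_norm _ _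

theorem abs_coord_le (v : Vec m) (j : Fin m) : |v j| ≤ ‖v‖ := PiLp.norm_apply_le v j

theorem psModel_pos (γ : Vec m) (x : Vec d) : 0 < psModel Φ γ x := by
  unfold psModel; positivity

theorem one_sub_psModel (γ : Vec m) (x : Vec d) :
    1 - psModel Φ γ x = (1 + Real.exp (lin Φ γ x))⁻¹ := by
  unfold psModel
  have := Real.exp_pos (lin Φ γ x)
  field_simp
  ring

theorem one_sub_psModel_pos (γ : Vec m) (x : Vec d) : 0 < 1 - psModel Φ γ x := by
  rw [one_sub_psModel]; positivity

theorem psModel_lt_one (γ : Vec m) (x : Vec d) : psModel Φ γ x < 1 :=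
  sub_pos.1 (one_sub_psModel_pos Φ γ x)

theorem psModel_eq_inv (γ : Vec m) (x : Vec d) :
    psModel Φ γ x = (1 + Real.exp (-lin Φ γ x))⁻¹ := by
  unfold psModel
  have := Real.exp_pos (lin Φ γ x)
  rw [Real.exp_neg]
  field_simp
  ring

theorem inv_psModel (γ : Vec m) (x : Vec d) :
    (psModel Φ γ x)⁻¹ = 1 + Real.exp (-lin Φ γ x) := by
  rw [psModel_eq_inv, inv_inv]

theorem inv_one_sub_psModel (γ : Vec m) (x : Vec d) :
    (1 - psModel Φ γ x)⁻¹ = 1 + Real.exp (lin Φ γ x) := by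
  rw [one_sub_psModel, inv_inv]

theorem one_sub_psModel_div (γ : Vec m) (x : Vec d) :
    (1 - psModel Φ γ x) / psModel Φ γ x = Real.exp (-lin Φ γ x) := by
  rw [sub_div, div_self (psModel_pos Φ γ x).ne', one_div, inv_psModel]; ring

theorem psModel_div_one_sub (γ : Vec m) (x : Vec d) :
    psModel Φ γ x / (1 - psModel Φ γ x) = Real.exp (lin Φ γ x) := by
  have h : psModel Φ γ x = 1 - (1 - psModel Φ γ x) := by ring
  rw [h, sub_div, ← h, div_self (one_sub_psModel_pos Φ γ x).ne', one_div, inv_one_sub_psModel]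
  ring

theorem log_psModel (γ : Vec m) (x : Vec d) :
    Real.log (psModel Φ γ x) = -Real.log (1 + Real.exp (-lin Φ γ x)) := by
  rw [psModel_eq_inv, Real.log_inv]

theorem log_one_sub_psModel (γ : Vec m) (x : Vec d) :
    Real.log (1 - psModel Φ γ x) = -Real.log (1 + Real.exp (lin Φ γ x)) := by
  rw [one_sub_psModel, Real.log_inv]

/-- The cross-entropy of a single observation, with the sign of the log-likelihood. -/
def logLik (γ : Vec m) (o : Obs d) : ℝ :=
  o.1 * Real.log (psModel Φ γ o.2.1) + (1 - o.1) * Real.log (1 - psModel Φ γ o.2.1)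

/-- The treated balance function whose empirical mean is constrained. -/
def treatedBalance (t₁ t₂ : Vec d → ℝ) (γ : Vec m) (j : Fin m) (o : Obs d) : ℝ :=
  (t₁ o.2.1 - t₂ o.2.1) * (1 - o.1 / psModel Φ γ o.2.1) * Φ o.2.1 j

/-- The control balance function whose empirical mean is constrained. -/
def controlBalance (t₁ t₂ : Vec d → ℝ) (γ : Vec m) (j : Fin m) (o : Obs d) : ℝ :=
  (t₁ o.2.1 - t₂ o.2.1) * (1 - (1 - o.1) / (1 - psModel Φ γ o.2.1)) * Φ o.2.1 j

/-- The score of the weighted least-squares loss in the treated group. -/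
def treatedScore (t₁ t₂ : Vec d → ℝ) (γ β : Vec m) (j : Fin m) (o : Obs d) : ℝ :=
  (t₁ o.2.1 - t₂ o.2.1) * (o.1 * Real.exp (-lin Φ γ o.2.1)) *
    ((o.2.2 - lin Φ β o.2.1) * Φ o.2.1 j)

/-- The score of the weighted least-squares loss in the control group. -/
def controlScore (t₁ t₂ : Vec d → ℝ) (γ β : Vec m) (j : Fin m) (o : Obs d) : ℝ :=
  (t₁ o.2.1 - t₂ o.2.1) * ((1 - o.1) * Real.exp (lin Φ γ o.2.1)) *
    ((o.2.2 - lin Φ β o.2.1) * Φ o.2.1 j)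

variable {Φ}

theorem ipw_of_treated {γ : Vec m} {o : Obs d} (h : o.1 = 1) :
    ipw Φ γ o = 1 + Real.exp (-lin Φ γ o.2.1) := by
  simp [ipw, h, inv_psModel]

theorem ipw_of_control {γ : Vec m} {o : Obs d} (h : o.1 = 0) :
    ipw Φ γ o = 1 + Real.exp (lin Φ γ o.2.1) := by
  simp [ipw, h, inv_one_sub_psModel]

theorem one_le_ipw {γ : Vec m} {o : Obs d} (h : o.1 = 0 ∨ o.1 = 1) : 1 ≤ ipw Φ γ o := by
  rcases h with h | h
  · rw [ipw_of_control h]; linarith [Real.exp_pos (lin Φ γ o.2.1)]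
  · rw [ipw_of_treated h]; linarith [Real.exp_pos (-lin Φ γ o.2.1)]

/-- The envelope without its exponential factor. -/
def baseEnvelope (t₁ t₂ : Vec d → ℝ) (Φ : Vec d → Vec m) (γ : Vec m) (o : Obs d) : ℝ :=
  |t₁ o.2.1 - t₂ o.2.1| * ipw Φ γ o * (1 + |o.2.2| + ‖Φ o.2.1‖)

variable {t₁ t₂ : Vec d → ℝ} {γ γ' β β' : Vec m} {r : ℝ} {o : Obs d}

theorem baseEnvelope_nonneg (h : o.1 = 0 ∨ o.1 = 1) : 0 ≤ baseEnvelope t₁ t₂ Φ γ o := by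
  have := one_le_ipw (Φ := Φ) (γ := γ) h
  unfold baseEnvelope
  positivity

theorem baseEnvelope_mul_le (hr : 0 < r) (h : o.1 = 0 ∨ o.1 = 1) :
    baseEnvelope t₁ t₂ Φ γ o *
        ((1 + ‖Φ o.2.1‖ + ‖Φ o.2.1‖ ^ 2) * Real.exp (r / 2 * ‖Φ o.2.1‖)) ≤
      (1 + 2 / r + 8 / r ^ 2) * envelope t₁ t₂ Φ γ r o := by
  calc _ ≤ baseEnvelope t₁ t₂ Φ γ o *
        ((1 + 2 / r + 8 / r ^ 2) * Real.exp (r * ‖Φ o.2.1‖)) :=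
        mul_le_mul_of_nonneg_left (one_add_add_sq_mul_exp_le hr (norm_nonneg _))
          (baseEnvelope_nonneg h)
    _ = _ := by unfold envelope baseEnvelope; ring

theorem baseEnvelope_le_envelope (hr : 0 < r) (h : o.1 = 0 ∨ o.1 = 1) :
    baseEnvelope t₁ t₂ Φ γ o ≤ envelope t₁ t₂ Φ γ r o :=
  le_mul_of_one_le_right (baseEnvelope_nonneg h) (Real.one_le_exp (by positivity))

theorem abs_mul_le_baseEnvelope {c e : ℝ} (h : o.1 = 0 ∨ o.1 = 1) (hc : |c| ≤ ipw Φ γ o)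
    (he : |e| ≤ 1 + |o.2.2| + ‖Φ o.2.1‖) :
    |(t₁ o.2.1 - t₂ o.2.1) * c * e| ≤ baseEnvelope t₁ t₂ Φ γ o := by
  have := one_le_ipw (Φ := Φ) (γ := γ) h
  rw [abs_mul, abs_mul]
  unfold baseEnvelope
  gcongr

theorem abs_treated_weight_le (h : o.1 = 0 ∨ o.1 = 1) :
    |o.1 * Real.exp (-lin Φ γ o.2.1)| ≤ ipw Φ γ o := by
  rcases h with h | h
  · have := one_le_ipw (Φ := Φ) (γ := γ) (o := o) (Or.inl h)
    rw [h]; simp; linarith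
  · rw [ipw_of_treated h, h, one_mul, abs_of_pos (Real.exp_pos _)]; linarith

theorem abs_control_weight_le (h : o.1 = 0 ∨ o.1 = 1) :
    |(1 - o.1) * Real.exp (lin Φ γ o.2.1)| ≤ ipw Φ γ o := by
  rcases h with h | h
  · rw [ipw_of_control h, h, sub_zero, one_mul, abs_of_pos (Real.exp_pos _)]; linarith
  · have := one_le_ipw (Φ := Φ) (γ := γ) (o := o) (Or.inr h)
    rw [h]; simp; linarith

theorem abs_one_sub_treated_le (h : o.1 = 0 ∨ o.1 = 1) :
    |1 - o.1 / psModel Φ γ o.2.1| ≤ ipw Φ γ o := by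
  rcases h with h | h
  · have := one_le_ipw (Φ := Φ) (γ := γ) (o := o) (Or.inl h)
    rw [h]; simpa using this
  · rw [ipw_of_treated h, h, one_div, inv_psModel, sub_add_cancel_left, abs_neg,
      abs_of_pos (Real.exp_pos _)]; linarith

theorem abs_one_sub_control_le (h : o.1 = 0 ∨ o.1 = 1) :
    |1 - (1 - o.1) / (1 - psModel Φ γ o.2.1)| ≤ ipw Φ γ o := by
  rcases h with h | h
  · rw [ipw_of_control h, h, sub_zero, one_div, inv_one_sub_psModel, sub_add_cancel_left, abs_neg,
      abs_of_pos (Real.exp_pos _)]; linarith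
  · have := one_le_ipw (Φ := Φ) (γ := γ) (o := o) (Or.inr h)
    rw [h]; simpa using this

theorem abs_treatedBalance_le (h : o.1 = 0 ∨ o.1 = 1) (j : Fin m) :
    |treatedBalance Φ t₁ t₂ γ j o| ≤ baseEnvelope t₁ t₂ Φ γ o :=
  abs_mul_le_baseEnvelope h (abs_one_sub_treated_le h)
    (by linarith [abs_coord_le (Φ o.2.1) j, abs_nonneg o.2.2])

theorem abs_controlBalance_le (h : o.1 = 0 ∨ o.1 = 1) (j : Fin m) :
    |controlBalance Φ t₁ t₂ γ j o| ≤ baseEnvelope t₁ t₂ Φ γ o :=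
  abs_mul_le_baseEnvelope h (abs_one_sub_control_le h)
    (by linarith [abs_coord_le (Φ o.2.1) j, abs_nonneg o.2.2])

theorem abs_residual_le (β : Vec m) (o : Obs d) :
    |o.2.2 - lin Φ β o.2.1| ≤ (1 + ‖β‖) * (1 + |o.2.2| + ‖Φ o.2.1‖) := by
  have h1 := abs_lin_le Φ β o.2.1
  have h2 := abs_sub (o.2.2) (lin Φ β o.2.1)
  nlinarith [norm_nonneg β, norm_nonneg (Φ o.2.1), abs_nonneg o.2.2]

/-- A bound for a product of the weight, an inverse-probability factor and a term that is dominated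
by the base envelope times a polynomial and an exponential in `‖Φ‖`. -/
theorem abs_mul_le_envelope {c e K : ℝ} (hr : 0 < r) (hK : 0 ≤ K) (h : o.1 = 0 ∨ o.1 = 1)
    (hc : |c| ≤ ipw Φ γ o)
    (he : |e| ≤ K * ((1 + |o.2.2| + ‖Φ o.2.1‖) *
      ((1 + ‖Φ o.2.1‖ + ‖Φ o.2.1‖ ^ 2) * Real.exp (r / 2 * ‖Φ o.2.1‖)))) :
    |(t₁ o.2.1 - t₂ o.2.1) * c * e| ≤
      K * (1 + 2 / r + 8 / r ^ 2) * envelope t₁ t₂ Φ γ r o := by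
  have h1 := one_le_ipw (Φ := Φ) (γ := γ) h
  have h2 := baseEnvelope_mul_le (t₁ := t₁) (t₂ := t₂) (Φ := Φ) (γ := γ) hr h
  calc |(t₁ o.2.1 - t₂ o.2.1) * c * e| ≤ |t₁ o.2.1 - t₂ o.2.1| * ipw Φ γ o * (K *
        ((1 + |o.2.2| + ‖Φ o.2.1‖) *
          ((1 + ‖Φ o.2.1‖ + ‖Φ o.2.1‖ ^ 2) * Real.exp (r / 2 * ‖Φ o.2.1‖)))) := by
        rw [abs_mul, abs_mul]; gcongr
    _ = K * (baseEnvelope t₁ t₂ Φ γ o *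
        ((1 + ‖Φ o.2.1‖ + ‖Φ o.2.1‖ ^ 2) * Real.exp (r / 2 * ‖Φ o.2.1‖))) := by
        unfold baseEnvelope; ring
    _ ≤ K * ((1 + 2 / r + 8 / r ^ 2) * envelope t₁ t₂ Φ γ r o) := by gcongr
    _ = _ := by ring

theorem abs_residual_mul_le (hr : 0 < r) (β : Vec m) (j : Fin m) :
    |(o.2.2 - lin Φ β o.2.1) * Φ o.2.1 j| ≤ (1 + ‖β‖) * ((1 + |o.2.2| + ‖Φ o.2.1‖) *
      ((1 + ‖Φ o.2.1‖ + ‖Φ o.2.1‖ ^ 2) * Real.exp (r / 2 * ‖Φ o.2.1‖))) := by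
  have h1 := abs_residual_le (Φ := Φ) β o
  have h2 : |Φ o.2.1 j| ≤ (1 + ‖Φ o.2.1‖ + ‖Φ o.2.1‖ ^ 2) * Real.exp (r / 2 * ‖Φ o.2.1‖) := by
    have h3 : 1 ≤ Real.exp (r / 2 * ‖Φ o.2.1‖) := Real.one_le_exp (by positivity)
    have h4 := abs_coord_le (Φ o.2.1) j
    calc |Φ o.2.1 j| ≤ 1 + ‖Φ o.2.1‖ + ‖Φ o.2.1‖ ^ 2 := by nlinarith
      _ ≤ _ := le_mul_of_one_le_right (by positivity) h3
  rw [abs_mul, ← mul_assoc]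
  gcongr

theorem abs_treatedScore_le (hr : 0 < r) (h : o.1 = 0 ∨ o.1 = 1) (j : Fin m) :
    |treatedScore Φ t₁ t₂ γ β j o| ≤
      (1 + ‖β‖) * (1 + 2 / r + 8 / r ^ 2) * envelope t₁ t₂ Φ γ r o :=
  abs_mul_le_envelope hr (by positivity) h (abs_treated_weight_le h) (abs_residual_mul_le hr β j)

theorem abs_controlScore_le (hr : 0 < r) (h : o.1 = 0 ∨ o.1 = 1) (j : Fin m) :
    |controlScore Φ t₁ t₂ γ β j o| ≤
      (1 + ‖β‖) * (1 + 2 / r + 8 / r ^ 2) * envelope t₁ t₂ Φ γ r o :=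
  abs_mul_le_envelope hr (by positivity) h (abs_control_weight_le h) (abs_residual_mul_le hr β j)

theorem exp_abs_lin_le (hγ : ‖γ' - γ‖ ≤ r / 2) (x : Vec d) :
    Real.exp |lin Φ (γ' - γ) x| ≤ Real.exp (r / 2 * ‖Φ x‖) := by
  refine Real.exp_le_exp.2 ((abs_lin_le Φ _ x).trans ?_)
  rw [mul_comm]
  gcongr

/-- Here `h` is the shift of the log-weight and `b` that of the regression. The increment equals
`(exp h - 1) * residual - exp h * b`, where each term carries a factor of first order in `D`.
Treated and control scores are the cases of opposite sign of `h`. -/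
theorem abs_score_increment_le {h b D : ℝ} (β : Vec m) (j : Fin m) (hD : 0 ≤ D)
    (hh : |h| ≤ ‖Φ o.2.1‖ * D) (hb : |b| ≤ ‖Φ o.2.1‖ * D)
    (hexp : Real.exp |h| ≤ Real.exp (r / 2 * ‖Φ o.2.1‖)) :
    |((Real.exp h * (o.2.2 - lin Φ β o.2.1 - b) - (o.2.2 - lin Φ β o.2.1)) * Φ o.2.1 j)| ≤
      ((2 + ‖β‖) * D) * ((1 + |o.2.2| + ‖Φ o.2.1‖) *
      ((1 + ‖Φ o.2.1‖ + ‖Φ o.2.1‖ ^ 2) * Real.exp (r / 2 * ‖Φ o.2.1‖))) := by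
  set N := ‖Φ o.2.1‖ with hN
  set E := Real.exp (r / 2 * N) with hE
  set S := 1 + |o.2.2| + N with hS
  have hN0 : 0 ≤ N := norm_nonneg _
  have hS1 : 1 ≤ S := by have := abs_nonneg o.2.2; linarith
  have hE0 : 0 < E := Real.exp_pos _
  have hND : 0 ≤ N * D := by positivity
  have h1 := abs_residual_le (Φ := Φ) β o
  have h2 : |Real.exp h - 1| ≤ N * D * E :=
    (abs_exp_sub_one_le_abs_mul_exp h).trans (by gcongr)
  have h3 : |Real.exp h| ≤ E := by
    rw [abs_of_pos (Real.exp_pos _)]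
    exact (Real.exp_le_exp.2 (le_abs_self h)).trans hexp
  have e : Real.exp h * (o.2.2 - lin Φ β o.2.1 - b) - (o.2.2 - lin Φ β o.2.1) =
      (Real.exp h - 1) * (o.2.2 - lin Φ β o.2.1) - Real.exp h * b := by ring
  have h4 : |Real.exp h * (o.2.2 - lin Φ β o.2.1 - b) - (o.2.2 - lin Φ β o.2.1)| ≤
      N * D * E * ((2 + ‖β‖) * S) := by
    rw [e]
    calc _ ≤ |(Real.exp h - 1) * (o.2.2 - lin Φ β o.2.1)| + |Real.exp h * b| := abs_sub _ _
      _ = |Real.exp h - 1| * |o.2.2 - lin Φ β o.2.1| + |Real.exp h| * |b| := by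
        rw [abs_mul, abs_mul]
      _ ≤ N * D * E * ((1 + ‖β‖) * S) + E * (N * D) := by gcongr
      _ ≤ N * D * E * ((1 + ‖β‖) * S) + E * (N * D) * S := by
        exact (add_le_add_iff_left _).2 (le_mul_of_one_le_right (by positivity) hS1)
      _ = _ := by ring
  rw [abs_mul]
  calc _ ≤ N * D * E * ((2 + ‖β‖) * S) * N := by
        gcongr; exact abs_coord_le _ _
    _ = (2 + ‖β‖) * S * E * (N * D) * N := by ring
    _ ≤ _ := by
      have : N ^ 2 ≤ 1 + N + N ^ 2 := by linarith
      calc (2 + ‖β‖) * S * E * (N * D) * N = (2 + ‖β‖) * D * (S * (N ^ 2 * E)) := by ring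
        _ ≤ _ := by gcongr

/-- Each term is a product of two first-order quantities or an exponential remainder of order two,
whence `D ^ 2`. -/
theorem abs_taylor_remainder_le {h b D : ℝ} (β : Vec m) (hD : 0 ≤ D)
    (hh : |h| ≤ ‖Φ o.2.1‖ * D) (hb : |b| ≤ ‖Φ o.2.1‖ * D)
    (hexp : Real.exp |h| ≤ Real.exp (r / 2 * ‖Φ o.2.1‖)) :
    |(o.2.2 - lin Φ β o.2.1) * (Real.exp h - 1 - h) - b * (Real.exp h - 1)| ≤
      ((2 + ‖β‖) * D ^ 2) * ((1 + |o.2.2| + ‖Φ o.2.1‖) *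
      ((1 + ‖Φ o.2.1‖ + ‖Φ o.2.1‖ ^ 2) * Real.exp (r / 2 * ‖Φ o.2.1‖))) := by
  set N := ‖Φ o.2.1‖ with hN
  set E := Real.exp (r / 2 * N) with hE
  set S := 1 + |o.2.2| + N with hS
  have hN0 : 0 ≤ N := norm_nonneg _
  have hS1 : 1 ≤ S := by have := abs_nonneg o.2.2; linarith
  have hE0 : 0 < E := Real.exp_pos _
  have hND : 0 ≤ N * D := by positivity
  have h1 := abs_residual_le (Φ := Φ) β o
  have h2 : |Real.exp h - 1| ≤ N * D * E :=
    (abs_exp_sub_one_le_abs_mul_exp h).trans (by gcongr)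
  have h3 : |Real.exp h - 1 - h| ≤ (N * D) ^ 2 * E := by
    refine (abs_exp_sub_one_sub_le_sq_mul_exp h).trans ?_
    rw [← sq_abs h]
    gcongr
  calc _ ≤ |(o.2.2 - lin Φ β o.2.1) * (Real.exp h - 1 - h)| + |b * (Real.exp h - 1)| := abs_sub _ _
    _ = |o.2.2 - lin Φ β o.2.1| * |Real.exp h - 1 - h| + |b| * |Real.exp h - 1| := by
      rw [abs_mul, abs_mul]
    _ ≤ ((1 + ‖β‖) * S) * ((N * D) ^ 2 * E) + N * D * (N * D * E) := by gcongr
    _ ≤ ((1 + ‖β‖) * S) * ((N * D) ^ 2 * E) + N * D * (N * D * E) * S := by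
      exact (add_le_add_iff_left _).2 (le_mul_of_one_le_right (by positivity) hS1)
    _ = (2 + ‖β‖) * D ^ 2 * (S * (N ^ 2 * E)) := by ring
    _ ≤ _ := by
      have : N ^ 2 ≤ 1 + N + N ^ 2 := by linarith
      gcongr

theorem lin_le_of_norm_le {D : ℝ} {v : Vec m} (hv : ‖v‖ ≤ D) (x : Vec d) :
    |lin Φ v x| ≤ ‖Φ x‖ * D :=
  (abs_lin_le Φ v x).trans (by gcongr)

theorem abs_treatedScore_sub_le (hr : 0 < r) (h : o.1 = 0 ∨ o.1 = 1) (j : Fin m)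
    (hγ : ‖γ' - γ‖ ≤ r / 2) :
    |treatedScore Φ t₁ t₂ γ' β' j o - treatedScore Φ t₁ t₂ γ β j o| ≤
      (2 + ‖β‖) * (‖γ' - γ‖ + ‖β' - β‖) * (1 + 2 / r + 8 / r ^ 2) *
        envelope t₁ t₂ Φ γ r o := by
  have e : treatedScore Φ t₁ t₂ γ' β' j o - treatedScore Φ t₁ t₂ γ β j o =
      (t₁ o.2.1 - t₂ o.2.1) * (o.1 * Real.exp (-lin Φ γ o.2.1)) *
        ((Real.exp (-lin Φ (γ' - γ) o.2.1) *
          (o.2.2 - lin Φ β o.2.1 - lin Φ (β' - β) o.2.1) - (o.2.2 - lin Φ β o.2.1)) *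
            Φ o.2.1 j) := by
    have h1 : -lin Φ γ' o.2.1 = -lin Φ γ o.2.1 + -lin Φ (γ' - γ) o.2.1 := by
      rw [lin_sub]; ring
    unfold treatedScore
    rw [h1, Real.exp_add, lin_sub Φ β']
    ring
  rw [e]
  refine abs_mul_le_envelope hr (by positivity) h (abs_treated_weight_le h)
    (abs_score_increment_le β j (by positivity) ?_ ?_ ?_)
  · rw [abs_neg]; exact lin_le_of_norm_le (by linarith [norm_nonneg (β' - β)]) _
  · exact lin_le_of_norm_le (by linarith [norm_nonneg (γ' - γ)]) _
  · rw [abs_neg]; exact exp_abs_lin_le hγ _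

theorem abs_controlScore_sub_le (hr : 0 < r) (h : o.1 = 0 ∨ o.1 = 1) (j : Fin m)
    (hγ : ‖γ' - γ‖ ≤ r / 2) :
    |controlScore Φ t₁ t₂ γ' β' j o - controlScore Φ t₁ t₂ γ β j o| ≤
      (2 + ‖β‖) * (‖γ' - γ‖ + ‖β' - β‖) * (1 + 2 / r + 8 / r ^ 2) *
        envelope t₁ t₂ Φ γ r o := by
  have e : controlScore Φ t₁ t₂ γ' β' j o - controlScore Φ t₁ t₂ γ β j o =
      (t₁ o.2.1 - t₂ o.2.1) * ((1 - o.1) * Real.exp (lin Φ γ o.2.1)) *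
        ((Real.exp (lin Φ (γ' - γ) o.2.1) *
          (o.2.2 - lin Φ β o.2.1 - lin Φ (β' - β) o.2.1) - (o.2.2 - lin Φ β o.2.1)) *
            Φ o.2.1 j) := by
    have h1 : lin Φ γ' o.2.1 = lin Φ γ o.2.1 + lin Φ (γ' - γ) o.2.1 := by
      rw [lin_sub]; ring
    unfold controlScore
    rw [h1, Real.exp_add, lin_sub Φ β']
    ring
  rw [e]
  refine abs_mul_le_envelope hr (by positivity) h (abs_control_weight_le h)
    (abs_score_increment_le β j (by positivity) ?_ ?_ (exp_abs_lin_le hγ _))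
  · exact lin_le_of_norm_le (by linarith [norm_nonneg (β' - β)]) _
  · exact lin_le_of_norm_le (by linarith [norm_nonneg (γ' - γ)]) _

theorem sum_mul_mul_coord (v : Vec m) (c : ℝ) (x : Vec d) :
    ∑ j, v j * (c * Φ x j) = c * lin Φ v x := by
  rw [lin, Finset.mul_sum]
  exact Finset.sum_congr rfl fun j _ => by ring

variable {β₀ β₁ β₀' β₁' : Vec m}

/-- The derivative of the model `φ` in the nuisance parameters, in the direction `(v, v₀, v₁)`. -/
def phiLinear (Φ : Vec d → Vec m) (t₁ t₂ : Vec d → ℝ) (γ β₀ β₁ v v₀ v₁ : Vec m)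
    (o : Obs d) : ℝ :=
  2 * (∑ j, v j * treatedScore Φ t₁ t₂ γ β₁ j o + ∑ j, v j * controlScore Φ t₁ t₂ γ β₀ j o +
    ∑ j, v₀ j * controlBalance Φ t₁ t₂ γ j o - ∑ j, v₁ j * treatedBalance Φ t₁ t₂ γ j o)

/-- A shift of γ multiplies the exponential weights by `exp (± h)`, and `phiModel` is affine in the
β's. The remainder is therefore an exact expression: in each group, residual times `exp (± h) - 1 ∓
h`, and a cross term from the joint shift of γ and β. No mean-value argument is needed. -/
theorem abs_phiModel_sub_sub_phiLinear_le (hr : 0 < r) (h : o.1 = 0 ∨ o.1 = 1)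
    (hγ : ‖γ' - γ‖ ≤ r / 2) :
    |phiModel t₁ t₂ Φ γ' β₀' β₁' o - phiModel t₁ t₂ Φ γ β₀ β₁ o -
        phiLinear Φ t₁ t₂ γ β₀ β₁ (γ' - γ) (β₀' - β₀) (β₁' - β₁) o| ≤
      (2 * ((4 + ‖β₀‖ + ‖β₁‖) * (1 + 2 / r + 8 / r ^ 2))) *
        (‖γ' - γ‖ + ‖β₀' - β₀‖ + ‖β₁' - β₁‖) ^ 2 * envelope t₁ t₂ Φ γ r o := by
  set D := ‖γ' - γ‖ + ‖β₀' - β₀‖ + ‖β₁' - β₁‖ with hD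
  have n1 := norm_nonneg (γ' - γ)
  have n2 := norm_nonneg (β₀' - β₀)
  have n3 := norm_nonneg (β₁' - β₁)
  have hD0 : 0 ≤ D := by positivity
  have e : phiModel t₁ t₂ Φ γ' β₀' β₁' o - phiModel t₁ t₂ Φ γ β₀ β₁ o -
        phiLinear Φ t₁ t₂ γ β₀ β₁ (γ' - γ) (β₀' - β₀) (β₁' - β₁) o =
      2 * ((t₁ o.2.1 - t₂ o.2.1) * ((1 - o.1) * Real.exp (lin Φ γ o.2.1)) *
        ((o.2.2 - lin Φ β₀ o.2.1) *
          (Real.exp (lin Φ (γ' - γ) o.2.1) - 1 - lin Φ (γ' - γ) o.2.1) -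
          lin Φ (β₀' - β₀) o.2.1 * (Real.exp (lin Φ (γ' - γ) o.2.1) - 1))) -
      2 * ((t₁ o.2.1 - t₂ o.2.1) * (o.1 * Real.exp (-lin Φ γ o.2.1)) *
        ((o.2.2 - lin Φ β₁ o.2.1) *
          (Real.exp (-lin Φ (γ' - γ) o.2.1) - 1 - -lin Φ (γ' - γ) o.2.1) -
          lin Φ (β₁' - β₁) o.2.1 * (Real.exp (-lin Φ (γ' - γ) o.2.1) - 1))) := by
    have h1 : lin Φ γ' o.2.1 = lin Φ γ o.2.1 + lin Φ (γ' - γ) o.2.1 := by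
      rw [lin_sub]; ring
    have h2 : lin Φ β₀' o.2.1 = lin Φ β₀ o.2.1 + lin Φ (β₀' - β₀) o.2.1 := by
      rw [lin_sub]; ring
    have h3 : lin Φ β₁' o.2.1 = lin Φ β₁ o.2.1 + lin Φ (β₁' - β₁) o.2.1 := by
      rw [lin_sub]; ring
    unfold phiLinear treatedScore controlScore treatedBalance controlBalance phiModel phi orModel
    -- Each summand is regrouped as (scalar) times `Φ x j`, so that the coordinate sums collapse to
    -- `lin`.
    simp only [← mul_assoc (_ * _) _ (Φ o.2.1 _)]
    simp only [sum_mul_mul_coord, div_eq_mul_inv, inv_psModel, inv_one_sub_psModel]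
    rw [h1, h2, h3, neg_add, Real.exp_add, Real.exp_add]
    ring
  rw [e]
  have hlin : |lin Φ (γ' - γ) o.2.1| ≤ ‖Φ o.2.1‖ * D := lin_le_of_norm_le (by linarith) _
  have b0 := abs_mul_le_envelope (t₁ := t₁) (t₂ := t₂) hr
    (K := (2 + ‖β₀‖) * D ^ 2) (by positivity) h (abs_control_weight_le (Φ := Φ) (γ := γ) h)
    (abs_taylor_remainder_le (b := lin Φ (β₀' - β₀) o.2.1) β₀ hD0 hlin
      (lin_le_of_norm_le (by linarith) _) (exp_abs_lin_le hγ _))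
  have b1 := abs_mul_le_envelope (t₁ := t₁) (t₂ := t₂) hr
    (K := (2 + ‖β₁‖) * D ^ 2) (by positivity) h (abs_treated_weight_le (Φ := Φ) (γ := γ) h)
    (abs_taylor_remainder_le (h := -lin Φ (γ' - γ) o.2.1) (b := lin Φ (β₁' - β₁) o.2.1) β₁ hD0
      (by rwa [abs_neg]) (lin_le_of_norm_le (by linarith) _)
      (by rw [abs_neg]; exact exp_abs_lin_le hγ _))
  refine (abs_sub _ _).trans ?_
  rw [abs_mul 2, abs_mul 2, abs_two]
  linarith

theorem logLik_eq (o : Obs d) : logLik Φ γ o =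
    -(o.1 * Real.log (1 + Real.exp (-lin Φ γ o.2.1)) +
      (1 - o.1) * Real.log (1 + Real.exp (lin Φ γ o.2.1))) := by
  rw [logLik, log_psModel, log_one_sub_psModel]; ring

theorem abs_logLik_le (h : o.1 = 0 ∨ o.1 = 1) :
    |logLik Φ γ o| ≤ 1 + ‖Φ o.2.1‖ * ‖γ‖ := by
  have h1 := abs_lin_le Φ γ o.2.1
  have h2 := abs_log_one_add_exp_le (lin Φ γ o.2.1)
  have h3 := abs_log_one_add_exp_le (-lin Φ γ o.2.1)
  rw [abs_neg] at h3
  rw [logLik_eq, abs_neg]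
  rcases h with h | h <;> simp only [h, zero_mul, one_mul, sub_zero, sub_self, zero_add, add_zero]
    <;> linarith

/-- The Lipschitz constant `‖Φ(X)‖` is integrable, which makes a law of large numbers at the limit
parameter sufficient for the estimated one. -/
theorem abs_logLik_sub_le (h : o.1 = 0 ∨ o.1 = 1) :
    |logLik Φ γ' o - logLik Φ γ o| ≤ ‖γ' - γ‖ * ‖Φ o.2.1‖ := by
  have h1 := abs_lin_le Φ (γ' - γ) o.2.1
  rw [lin_sub, mul_comm] at h1
  have h2 := abs_log_one_add_exp_sub_le (lin Φ γ o.2.1) (lin Φ γ' o.2.1)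
  have h3 := abs_log_one_add_exp_sub_le (-lin Φ γ o.2.1) (-lin Φ γ' o.2.1)
  rw [abs_sub_comm (lin Φ γ o.2.1)] at h2
  rw [neg_sub_neg] at h3
  rw [logLik_eq, logLik_eq, neg_sub_neg]
  rcases h with h | h <;> simp only [h, zero_mul, one_mul, sub_zero, sub_self, zero_add, add_zero]
    <;> linarith

end Models

/-! ### Linearity and domination for empirical means. -/

section EmpMean

variable {d : ℕ} {n : ℕ} {z : ℕ → Obs d} {f g : Obs d → ℝ}

theorem empMean_sub : empMean n z (fun o => f o - g o) = empMean n z f - empMean n z g := by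
  simp [empMean, Finset.sum_sub_distrib, mul_sub]

theorem empMean_add : empMean n z (fun o => f o + g o) = empMean n z f + empMean n z g := by
  simp [empMean, Finset.sum_add_distrib, mul_add]

theorem empMean_const_mul (c : ℝ) : empMean n z (fun o => c * f o) = c * empMean n z f := by
  simp only [empMean, ← Finset.mul_sum]; ring

theorem empMean_sum {ι : Type*} (s : Finset ι) (F : ι → Obs d → ℝ) :
    empMean n z (fun o => ∑ j ∈ s, F j o) = ∑ j ∈ s, empMean n z (F j) := by
  simp only [empMean]
  rw [Finset.sum_comm, Finset.mul_sum]

theorem abs_empMean_le {G : Obs d → ℝ} {c : ℝ} (h : ∀ i, |f (z i)| ≤ c * G (z i)) :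
    |empMean n z f| ≤ c * empMean n z G := by
  rw [← empMean_const_mul]
  unfold empMean
  rw [abs_mul, abs_of_nonneg (by positivity : (0 : ℝ) ≤ 1 / n)]
  gcongr
  exact (Finset.abs_sum_le_sum_abs _ _).trans (Finset.sum_le_sum fun i _ => h i)

theorem abs_empMean_sub_le {G : Obs d → ℝ} {c : ℝ} (h : ∀ i, |f (z i) - g (z i)| ≤ c * G (z i)) :
    |empMean n z f - empMean n z g| ≤ c * empMean n z G := by
  rw [← empMean_sub]
  exact abs_empMean_le h

end EmpMean

/-! ### Measurability of the models, scores and envelope. -/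

section Measurability

variable {d m : ℕ} {Φ : Vec d → Vec m} {t₁ t₂ : Vec d → ℝ}

theorem measurable_coord (hΦ : Measurable Φ) (j : Fin m) : Measurable fun x => Φ x j := by
  fun_prop

theorem measurable_lin {α : Type*} [MeasurableSpace α] (hΦ : Measurable Φ) {b : α → Vec m}
    {x : α → Vec d} (hb : Measurable b) (hx : Measurable x) :
    Measurable fun a => lin Φ (b a) (x a) := by
  unfold lin
  refine Finset.measurable_sum _ fun j _ => ?_
  exact ((measurable_coord hΦ j).comp hx).mul (by fun_prop)

theorem measurable_psModel {α : Type*} [MeasurableSpace α] (hΦ : Measurable Φ) {b : α → Vec m}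
    {x : α → Vec d} (hb : Measurable b) (hx : Measurable x) :
    Measurable fun a => psModel Φ (b a) (x a) := by
  have h := measurable_lin hΦ hb hx
  unfold psModel
  fun_prop

theorem measurable_psModel_const (hΦ : Measurable Φ) (γ : Vec m) : Measurable (psModel Φ γ) :=
  measurable_psModel hΦ measurable_const measurable_id

theorem measurable_lin_const (hΦ : Measurable Φ) (γ : Vec m) : Measurable (lin Φ γ) :=
  measurable_lin hΦ measurable_const measurable_id

theorem measurable_phiModel {α : Type*} [MeasurableSpace α] (ht₁ : Measurable t₁)
    (ht₂ : Measurable t₂) (hΦ : Measurable Φ) {γ β₀ β₁ : α → Vec m} {z : α → Obs d}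
    (hγ : Measurable γ) (hβ₀ : Measurable β₀) (hβ₁ : Measurable β₁) (hz : Measurable z) :
    Measurable fun a => phiModel t₁ t₂ Φ (γ a) (β₀ a) (β₁ a) (z a) := by
  have hx : Measurable fun a => (z a).2.1 := by fun_prop
  have h1 := measurable_psModel hΦ hγ hx
  have h2 := measurable_lin hΦ hβ₀ hx
  have h3 := measurable_lin hΦ hβ₁ hx
  have h4 : Measurable fun a => t₁ (z a).2.1 := ht₁.comp hx
  have h5 : Measurable fun a => t₂ (z a).2.1 := ht₂.comp hx
  have h6 : Measurable fun a => (z a).1 := by fun_prop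
  have h7 : Measurable fun a => (z a).2.2 := by fun_prop
  unfold phiModel phi orModel
  dsimp only
  fun_prop

theorem measurable_logLik (hΦ : Measurable Φ) (γ : Vec m) : Measurable (logLik Φ γ) := by
  have h := measurable_psModel_const hΦ γ
  unfold logLik
  fun_prop

theorem measurable_treatedBalance (ht₁ : Measurable t₁) (ht₂ : Measurable t₂)
    (hΦ : Measurable Φ) (γ : Vec m) (j : Fin m) : Measurable (treatedBalance Φ t₁ t₂ γ j) := by
  have h := measurable_psModel_const hΦ γ
  have h2 := measurable_coord hΦ j
  unfold treatedBalance
  fun_prop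

theorem measurable_controlBalance (ht₁ : Measurable t₁) (ht₂ : Measurable t₂)
    (hΦ : Measurable Φ) (γ : Vec m) (j : Fin m) : Measurable (controlBalance Φ t₁ t₂ γ j) := by
  have h := measurable_psModel_const hΦ γ
  have h2 := measurable_coord hΦ j
  unfold controlBalance
  fun_prop

theorem measurable_treatedScore (ht₁ : Measurable t₁) (ht₂ : Measurable t₂)
    (hΦ : Measurable Φ) (γ β : Vec m) (j : Fin m) :
    Measurable (treatedScore Φ t₁ t₂ γ β j) := by
  have h := measurable_lin_const hΦ γ
  have h1 := measurable_lin_const hΦ β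
  have h2 := measurable_coord hΦ j
  unfold treatedScore
  fun_prop

theorem measurable_controlScore (ht₁ : Measurable t₁) (ht₂ : Measurable t₂)
    (hΦ : Measurable Φ) (γ β : Vec m) (j : Fin m) :
    Measurable (controlScore Φ t₁ t₂ γ β j) := by
  have h := measurable_lin_const hΦ γ
  have h1 := measurable_lin_const hΦ β
  have h2 := measurable_coord hΦ j
  unfold controlScore
  fun_prop

theorem measurable_envelope (ht₁ : Measurable t₁) (ht₂ : Measurable t₂)
    (hΦ : Measurable Φ) (γ : Vec m) (r : ℝ) : Measurable (envelope t₁ t₂ Φ γ r) := by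
  have h := measurable_psModel_const hΦ γ
  unfold envelope ipw
  fun_prop

end Measurability

/-! ### Population identities under a correct propensity score. -/

section Population

variable {d m : ℕ} {pop : Measure (PopUnit d)}
  {Φ : Vec d → Vec m} {t₁ t₂ : Vec d → ℝ} {γ : Vec m}

theorem treat_mul_outcome (u : PopUnit d) :
    PopUnit.treat u * PopUnit.outcome u = PopUnit.treat u * PopUnit.y1 u := by
  unfold PopUnit.outcome
  rcases treat_eq u with h | h <;> simp [h]

theorem one_sub_treat_mul_outcome (u : PopUnit d) :
    (1 - PopUnit.treat u) * PopUnit.outcome u = (1 - PopUnit.treat u) * PopUnit.y0 u := by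
  unfold PopUnit.outcome
  rcases treat_eq u with h | h <;> simp [h]

theorem memLp_of_abs_le_mul_envelope {f : Obs d → ℝ} {K r : ℝ} (hf : Measurable f)
    (henv : MemLp (fun u => envelope t₁ t₂ Φ γ r (PopUnit.obs u)) 2 pop)
    (hle : ∀ o : Obs d, (o.1 = 0 ∨ o.1 = 1) → |f o| ≤ K * envelope t₁ t₂ Φ γ r o) :
    MemLp (fun u => f (PopUnit.obs u)) 2 pop := by
  refine (henv.const_mul K).mono' (hf.comp measurable_obs).aestronglyMeasurable
    (ae_of_all _ fun u => ?_)
  exact hle _ (treat_eq u)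

variable [IsProbabilityMeasure pop]

/-- Inverse-probability weighting: the treatment may be replaced by its propensity score, which then
cancels against the denominator. -/
theorem integral_treat_div_mul (h_unconf : Unconfounded pop) (hΦ : Measurable Φ)
    (hps : propensity pop =ᵐ[pop] fun u => psModel Φ γ (PopUnit.cov u))
    {F : Vec d × ℝ × ℝ → ℝ} (hF : Measurable F) :
    (Integrable (fun u => PopUnit.treat u / psModel Φ γ (PopUnit.cov u) *
        F (PopUnit.cov u, PopUnit.y0 u, PopUnit.y1 u)) pop ↔
      Integrable (fun u => F (PopUnit.cov u, PopUnit.y0 u, PopUnit.y1 u)) pop) ∧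
    ∫ u, PopUnit.treat u / psModel Φ γ (PopUnit.cov u) *
        F (PopUnit.cov u, PopUnit.y0 u, PopUnit.y1 u) ∂pop =
      ∫ u, F (PopUnit.cov u, PopUnit.y0 u, PopUnit.y1 u) ∂pop := by
  have hp := measurable_psModel_const hΦ γ
  obtain ⟨h1, h2⟩ := integral_treat_mul h_unconf hp (fun x => (psModel_pos Φ γ x).le) hps
    (F := fun q => F q / psModel Φ γ q.1) (by fun_prop)
  have e1 : ∀ u : PopUnit d, psModel Φ γ (PopUnit.cov u) *
      (F (PopUnit.cov u, PopUnit.y0 u, PopUnit.y1 u) / psModel Φ γ (PopUnit.cov u)) =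
      F (PopUnit.cov u, PopUnit.y0 u, PopUnit.y1 u) := fun u =>
    mul_div_cancel₀ _ (psModel_pos Φ γ _).ne'
  have e2 : ∀ u : PopUnit d, PopUnit.treat u *
      (F (PopUnit.cov u, PopUnit.y0 u, PopUnit.y1 u) / psModel Φ γ (PopUnit.cov u)) =
      PopUnit.treat u / psModel Φ γ (PopUnit.cov u) *
        F (PopUnit.cov u, PopUnit.y0 u, PopUnit.y1 u) := fun u => by ring
  simp only [e1, e2] at h1 h2
  exact ⟨h1, h2⟩

theorem integral_one_sub_treat_div_mul (h_unconf : Unconfounded pop) (hΦ : Measurable Φ)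
    (hps : propensity pop =ᵐ[pop] fun u => psModel Φ γ (PopUnit.cov u))
    {F : Vec d × ℝ × ℝ → ℝ} (hF : Measurable F) :
    (Integrable (fun u => (1 - PopUnit.treat u) / (1 - psModel Φ γ (PopUnit.cov u)) *
        F (PopUnit.cov u, PopUnit.y0 u, PopUnit.y1 u)) pop ↔
      Integrable (fun u => F (PopUnit.cov u, PopUnit.y0 u, PopUnit.y1 u)) pop) ∧
    ∫ u, (1 - PopUnit.treat u) / (1 - psModel Φ γ (PopUnit.cov u)) *
        F (PopUnit.cov u, PopUnit.y0 u, PopUnit.y1 u) ∂pop =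
      ∫ u, F (PopUnit.cov u, PopUnit.y0 u, PopUnit.y1 u) ∂pop := by
  have hp := measurable_psModel_const hΦ γ
  obtain ⟨h1, h2⟩ := integral_one_sub_treat_mul h_unconf hp (fun x => (psModel_lt_one Φ γ x).le) hps
    (F := fun q => F q / (1 - psModel Φ γ q.1)) (by fun_prop)
  have e1 : ∀ u : PopUnit d, (1 - psModel Φ γ (PopUnit.cov u)) *
      (F (PopUnit.cov u, PopUnit.y0 u, PopUnit.y1 u) / (1 - psModel Φ γ (PopUnit.cov u))) =
      F (PopUnit.cov u, PopUnit.y0 u, PopUnit.y1 u) := fun u =>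
    mul_div_cancel₀ _ (one_sub_psModel_pos Φ γ _).ne'
  have e2 : ∀ u : PopUnit d, (1 - PopUnit.treat u) *
      (F (PopUnit.cov u, PopUnit.y0 u, PopUnit.y1 u) / (1 - psModel Φ γ (PopUnit.cov u))) =
      (1 - PopUnit.treat u) / (1 - psModel Φ γ (PopUnit.cov u)) *
        F (PopUnit.cov u, PopUnit.y0 u, PopUnit.y1 u) := fun u => by ring
  simp only [e1, e2] at h1 h2
  exact ⟨h1, h2⟩

/-- A weight `k(X)` is balanced by the inverse propensity score in the treated group. -/
theorem integral_one_sub_treat_div_ps (h_unconf : Unconfounded pop) (hΦ : Measurable Φ)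
    (hps : propensity pop =ᵐ[pop] fun u => psModel Φ γ (PopUnit.cov u))
    {k : Vec d → ℝ} (hk : Measurable k) (hint : Integrable (fun u => k (PopUnit.cov u)) pop) :
    Integrable (fun u => (1 - PopUnit.treat u / psModel Φ γ (PopUnit.cov u)) *
        k (PopUnit.cov u)) pop ∧
    ∫ u, (1 - PopUnit.treat u / psModel Φ γ (PopUnit.cov u)) * k (PopUnit.cov u) ∂pop = 0 := by
  obtain ⟨h1, h2⟩ := integral_treat_div_mul h_unconf hΦ hps (F := fun q => k q.1) (by fun_prop)
  simp only [sub_mul, one_mul]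
  exact ⟨hint.sub (h1.2 hint), by rw [integral_sub hint (h1.2 hint), h2, sub_self]⟩

/-- A weight `k(X)` is balanced by the inverse propensity score in the control group. -/
theorem integral_one_sub_control_div_ps (h_unconf : Unconfounded pop) (hΦ : Measurable Φ)
    (hps : propensity pop =ᵐ[pop] fun u => psModel Φ γ (PopUnit.cov u))
    {k : Vec d → ℝ} (hk : Measurable k) (hint : Integrable (fun u => k (PopUnit.cov u)) pop) :
    Integrable (fun u => (1 - (1 - PopUnit.treat u) / (1 - psModel Φ γ (PopUnit.cov u))) *
        k (PopUnit.cov u)) pop ∧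
    ∫ u, (1 - (1 - PopUnit.treat u) / (1 - psModel Φ γ (PopUnit.cov u))) *
        k (PopUnit.cov u) ∂pop = 0 := by
  obtain ⟨h1, h2⟩ := integral_one_sub_treat_div_mul h_unconf hΦ hps (F := fun q => k q.1)
    (by fun_prop)
  simp only [sub_mul _ _ (k _), one_mul]
  exact ⟨hint.sub (h1.2 hint), by rw [integral_sub hint (h1.2 hint), h2, sub_self]⟩

theorem integral_treatedBalance (h_unconf : Unconfounded pop) (hΦ : Measurable Φ)
    (ht₁ : Measurable t₁) (ht₂ : Measurable t₂)
    (hps : propensity pop =ᵐ[pop] fun u => psModel Φ γ (PopUnit.cov u)) (j : Fin m)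
    (hint : Integrable (fun u => (t₁ (PopUnit.cov u) - t₂ (PopUnit.cov u)) *
      Φ (PopUnit.cov u) j) pop) :
    Integrable (fun u => treatedBalance Φ t₁ t₂ γ j (PopUnit.obs u)) pop ∧
    ∫ u, treatedBalance Φ t₁ t₂ γ j (PopUnit.obs u) ∂pop = 0 := by
  have h2 := measurable_coord hΦ j
  obtain ⟨a, b⟩ := integral_one_sub_treat_div_ps h_unconf hΦ hps
    (k := fun x => (t₁ x - t₂ x) * Φ x j) (by fun_prop) hint
  have e : ∀ u : PopUnit d, (1 - PopUnit.treat u / psModel Φ γ (PopUnit.cov u)) *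
      ((t₁ (PopUnit.cov u) - t₂ (PopUnit.cov u)) * Φ (PopUnit.cov u) j) =
      treatedBalance Φ t₁ t₂ γ j (PopUnit.obs u) := fun u => by
    unfold treatedBalance PopUnit.obs; ring
  simp only [e] at a b
  exact ⟨a, b⟩

theorem integral_controlBalance (h_unconf : Unconfounded pop) (hΦ : Measurable Φ)
    (ht₁ : Measurable t₁) (ht₂ : Measurable t₂)
    (hps : propensity pop =ᵐ[pop] fun u => psModel Φ γ (PopUnit.cov u)) (j : Fin m)
    (hint : Integrable (fun u => (t₁ (PopUnit.cov u) - t₂ (PopUnit.cov u)) *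
      Φ (PopUnit.cov u) j) pop) :
    Integrable (fun u => controlBalance Φ t₁ t₂ γ j (PopUnit.obs u)) pop ∧
    ∫ u, controlBalance Φ t₁ t₂ γ j (PopUnit.obs u) ∂pop = 0 := by
  have h2 := measurable_coord hΦ j
  obtain ⟨a, b⟩ := integral_one_sub_control_div_ps h_unconf hΦ hps
    (k := fun x => (t₁ x - t₂ x) * Φ x j) (by fun_prop) hint
  have e : ∀ u : PopUnit d, (1 - (1 - PopUnit.treat u) / (1 - psModel Φ γ (PopUnit.cov u))) *
      ((t₁ (PopUnit.cov u) - t₂ (PopUnit.cov u)) * Φ (PopUnit.cov u) j) =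
      controlBalance Φ t₁ t₂ γ j (PopUnit.obs u) := fun u => by
    unfold controlBalance PopUnit.obs; ring
  simp only [e] at a b
  exact ⟨a, b⟩

theorem integrable_logLik (hΦ : Measurable Φ)
    (hΦ_int : Integrable (fun u => Φ (PopUnit.cov u)) pop) (γ : Vec m) :
    Integrable (fun u => logLik Φ γ (PopUnit.obs u)) pop := by
  refine ((integrable_const (1 : ℝ)).add (hΦ_int.norm.mul_const ‖γ‖)).mono'
    ((measurable_logLik hΦ γ).comp measurable_obs).aestronglyMeasurable (ae_of_all _ fun u => ?_)
  exact abs_logLik_le (treat_eq u)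

theorem integral_logLik (h_unconf : Unconfounded pop) (hΦ : Measurable Φ)
    (hΦ_int : Integrable (fun u => Φ (PopUnit.cov u)) pop) {γs : Vec m}
    (hps : propensity pop =ᵐ[pop] fun u => psModel Φ γs (PopUnit.cov u)) (γ : Vec m) :
    Integrable (fun u => psModel Φ γs (PopUnit.cov u) * Real.log (psModel Φ γ (PopUnit.cov u)) +
      (1 - psModel Φ γs (PopUnit.cov u)) * Real.log (1 - psModel Φ γ (PopUnit.cov u))) pop ∧
    ∫ u, logLik Φ γ (PopUnit.obs u) ∂pop =
      ∫ u, (psModel Φ γs (PopUnit.cov u) * Real.log (psModel Φ γ (PopUnit.cov u)) +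
        (1 - psModel Φ γs (PopUnit.cov u)) * Real.log (1 - psModel Φ γ (PopUnit.cov u))) ∂pop := by
  have hp := measurable_psModel_const hΦ γ
  have hL := integrable_logLik (pop := pop) hΦ hΦ_int γ
  -- The treatment is binary, so only one of the two terms of `logLik` survives and it dominates
  -- this one.
  have i1 : Integrable (fun u => PopUnit.treat u * Real.log (psModel Φ γ (PopUnit.cov u))) pop := by
    refine hL.mono (measurable_treat.mul
      ((hp.comp measurable_cov).log)).aestronglyMeasurable (ae_of_all _ fun u => ?_)
    change |_| ≤ |_|
    unfold logLik PopUnit.obs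
    rcases treat_eq u with h | h <;> simp [h]
  have i0 : Integrable (fun u => (1 - PopUnit.treat u) *
      Real.log (1 - psModel Φ γ (PopUnit.cov u))) pop := by
    refine hL.mono ((measurable_const.sub measurable_treat).mul
      ((measurable_const.sub (hp.comp measurable_cov)).log)).aestronglyMeasurable
      (ae_of_all _ fun u => ?_)
    change |_| ≤ |_|
    unfold logLik PopUnit.obs
    rcases treat_eq u with h | h <;> simp [h]
  obtain ⟨a1, b1⟩ := integral_treat_mul h_unconf (measurable_psModel_const hΦ γs)
    (fun x => (psModel_pos Φ γs x).le) hps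
    (F := fun q => Real.log (psModel Φ γ q.1)) (by fun_prop)
  obtain ⟨a0, b0⟩ := integral_one_sub_treat_mul h_unconf (measurable_psModel_const hΦ γs)
    (fun x => (psModel_lt_one Φ γs x).le) hps
    (F := fun q => Real.log (1 - psModel Φ γ q.1)) (by fun_prop)
  refine ⟨(a1.1 i1).add (a0.1 i0), ?_⟩
  rw [integral_add (a1.1 i1) (a0.1 i0), ← b1, ← b0, ← integral_add i1 i0]
  rfl

/-- Under correct specification, a parameter whose expected log-likelihood is not below that of the
true parameter yields the true propensity score. -/
theorem psModel_ae_eq_of_integral_logLik_le (h_unconf : Unconfounded pop) (hΦ : Measurable Φ)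
    (hΦ_int : Integrable (fun u => Φ (PopUnit.cov u)) pop) {γs : Vec m}
    (hps : propensity pop =ᵐ[pop] fun u => psModel Φ γs (PopUnit.cov u))
    (hle : ∫ u, logLik Φ γs (PopUnit.obs u) ∂pop ≤ ∫ u, logLik Φ γ (PopUnit.obs u) ∂pop) :
    propensity pop =ᵐ[pop] fun u => psModel Φ γ (PopUnit.cov u) := by
  obtain ⟨i1, e1⟩ := integral_logLik h_unconf hΦ hΦ_int hps γ
  obtain ⟨i2, e2⟩ := integral_logLik h_unconf hΦ hΦ_int hps γs
  rw [e1, e2] at hle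
  have hgibbs := fun x => bernoulli_gibbs (psModel_pos Φ γs x) (psModel_lt_one Φ γs x)
    (psModel_pos Φ γ x) (psModel_lt_one Φ γ x)
  -- Gibbs' inequality holds pointwise, so equal integrals force equality almost everywhere.
  have heq := (integral_eq_iff_of_ae_le i1 i2 (ae_of_all _ fun u => (hgibbs _).1)).1
    (le_antisymm (integral_mono i1 i2 fun u => (hgibbs _).1) hle)
  filter_upwards [heq, hps] with u h1 h2
  rw [h2]
  exact ((hgibbs _).2 h1).symm

theorem integrable_of_abs_le_baseEnvelope {f : Obs d → ℝ} {r : ℝ} (hr : 0 < r)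
    (henv : MemLp (fun u => envelope t₁ t₂ Φ γ r (PopUnit.obs u)) 2 pop) (hf : Measurable f)
    (hle : ∀ o : Obs d, (o.1 = 0 ∨ o.1 = 1) → |f o| ≤ baseEnvelope t₁ t₂ Φ γ o) :
    Integrable (fun u => f (PopUnit.obs u)) pop :=
  (memLp_of_abs_le_mul_envelope (K := 1) hf henv fun o ho =>
    (hle o ho).trans (by rw [one_mul]; exact baseEnvelope_le_envelope hr ho)).integrable one_le_two

theorem integrable_diff_mul_coord (hΦ : Measurable Φ) (ht₁ : Measurable t₁)
    (ht₂ : Measurable t₂) {r : ℝ} (hr : 0 < r)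
    (henv : MemLp (fun u => envelope t₁ t₂ Φ γ r (PopUnit.obs u)) 2 pop) (j : Fin m) :
    Integrable (fun u => (t₁ (PopUnit.cov u) - t₂ (PopUnit.cov u)) * Φ (PopUnit.cov u) j) pop := by
  have h2 := measurable_coord hΦ j
  refine integrable_of_abs_le_baseEnvelope (f := fun o => (t₁ o.2.1 - t₂ o.2.1) * Φ o.2.1 j)
    hr henv (by fun_prop) fun o ho => ?_
  -- The dummy weight 1 is admissible because the inverse-probability weight is at least 1.
  rw [← mul_one (t₁ o.2.1 - t₂ o.2.1)]
  exact abs_mul_le_baseEnvelope ho (by simpa using one_le_ipw ho)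
    (by linarith [abs_coord_le (Φ o.2.1) j, abs_nonneg o.2.2])

/-- Under unconfoundedness and correct specification of the propensity score, `φ` is unbiased for
the relative error, whatever the outcome regression. -/
theorem integral_phiModel_eq_relError (h_unconf : Unconfounded pop) (hΦ : Measurable Φ)
    (ht₁ : Measurable t₁) (ht₂ : Measurable t₂)
    (hy0 : Integrable PopUnit.y0 pop) (hy1 : Integrable PopUnit.y1 pop)
    (h_abs₁ : Integrable (fun u => (t₁ (PopUnit.cov u) - cate pop u) ^ 2) pop)
    (h_abs₂ : Integrable (fun u => (t₂ (PopUnit.cov u) - cate pop u) ^ 2) pop)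
    (hps : propensity pop =ᵐ[pop] fun u => psModel Φ γ (PopUnit.cov u)) (β₀ β₁ : Vec m)
    (hphi : Integrable (fun u => phiModel t₁ t₂ Φ γ β₀ β₁ (PopUnit.obs u)) pop) {r : ℝ}
    (hr : 0 < r) (henv : MemLp (fun u => envelope t₁ t₂ Φ γ r (PopUnit.obs u)) 2 pop) :
    ∫ u, phiModel t₁ t₂ Φ γ β₀ β₁ (PopUnit.obs u) ∂pop = relError pop t₁ t₂ := by
  have hp := measurable_psModel_const hΦ γ
  have hw : Measurable fun x => t₁ x - t₂ x := ht₁.sub ht₂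
  have iΦ := integrable_diff_mul_coord hΦ ht₁ ht₂ hr henv
  have ilin : ∀ b : Vec m, Integrable (fun u => (t₁ (PopUnit.cov u) - t₂ (PopUnit.cov u)) *
      lin Φ b (PopUnit.cov u)) pop := fun b => by
    have : ∀ u : PopUnit d, (t₁ (PopUnit.cov u) - t₂ (PopUnit.cov u)) * lin Φ b (PopUnit.cov u) =
        ∑ j, b j * ((t₁ (PopUnit.cov u) - t₂ (PopUnit.cov u)) * Φ (PopUnit.cov u) j) := fun u =>
      (sum_mul_mul_coord b _ _).symm
    simp only [this]
    exact integrable_finsetSum _ fun j _ => (iΦ j).const_mul _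
  have iY1 : Integrable (fun u => PopUnit.treat u / psModel Φ γ (PopUnit.cov u) *
      ((t₁ (PopUnit.cov u) - t₂ (PopUnit.cov u)) * PopUnit.y1 u)) pop := by
    have h := integrable_of_abs_le_baseEnvelope hr henv (f := fun o => (t₁ o.2.1 - t₂ o.2.1) * (o.1 / psModel Φ γ o.2.1) * o.2.2)
      (by fun_prop) fun o ho => by
        refine abs_mul_le_baseEnvelope ho ?_ (by linarith [abs_nonneg o.2.2, norm_nonneg (Φ o.2.1)])
        rcases ho with h | h
        · have := one_le_ipw (Φ := Φ) (γ := γ) (o := o) (Or.inl h)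
          simp [h]; linarith
        · rw [ipw_of_treated h, h, one_div, inv_psModel, abs_of_pos (by positivity)]
    refine h.congr (ae_of_all _ fun u => ?_)
    have := treat_mul_outcome u
    simp only [PopUnit.obs]
    linear_combination ((t₁ (PopUnit.cov u) - t₂ (PopUnit.cov u)) /
      psModel Φ γ (PopUnit.cov u)) * this
  have iY0 : Integrable (fun u => (1 - PopUnit.treat u) / (1 - psModel Φ γ (PopUnit.cov u)) *
      ((t₁ (PopUnit.cov u) - t₂ (PopUnit.cov u)) * PopUnit.y0 u)) pop := by
    have h := integrable_of_abs_le_baseEnvelope hr henv (f := fun o => (t₁ o.2.1 - t₂ o.2.1) *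
        ((1 - o.1) / (1 - psModel Φ γ o.2.1)) * o.2.2)
      (by fun_prop) fun o ho => by
        refine abs_mul_le_baseEnvelope ho ?_ (by linarith [abs_nonneg o.2.2, norm_nonneg (Φ o.2.1)])
        rcases ho with h | h
        · rw [ipw_of_control h, h, sub_zero, one_div, inv_one_sub_psModel,
            abs_of_pos (by positivity)]
        · have := one_le_ipw (Φ := Φ) (γ := γ) (o := o) (Or.inr h)
          simp [h]; linarith
    refine h.congr (ae_of_all _ fun u => ?_)
    have := one_sub_treat_mul_outcome u
    simp only [PopUnit.obs]
    linear_combination ((t₁ (PopUnit.cov u) - t₂ (PopUnit.cov u)) /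
      (1 - psModel Φ γ (PopUnit.cov u))) * this
  obtain ⟨j1, e1⟩ := integral_treat_div_mul h_unconf hΦ hps
    (F := fun q => (t₁ q.1 - t₂ q.1) * q.2.2) (by fun_prop)
  obtain ⟨j0, e0⟩ := integral_one_sub_treat_div_mul h_unconf hΦ hps
    (F := fun q => (t₁ q.1 - t₂ q.1) * q.2.1) (by fun_prop)
  have hl := fun b => measurable_lin_const hΦ b
  obtain ⟨k1, f1⟩ := integral_one_sub_treat_div_ps h_unconf hΦ hps
    (k := fun x => (t₁ x - t₂ x) * lin Φ β₁ x) (hw.mul (hl β₁)) (ilin β₁)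
  obtain ⟨k0, f0⟩ := integral_one_sub_control_div_ps h_unconf hΦ hps
    (k := fun x => (t₁ x - t₂ x) * lin Φ β₀ x) (hw.mul (hl β₀)) (ilin β₀)
  -- The envelope controls observed outcomes only. Integrability of the weighted potential outcomes
  -- is recovered from it by reading the equivalence backwards.
  have iw1 := j1.1 iY1
  have iw0 := j0.1 iY0
  dsimp only at iw1 iw0 e1 e0 k1 f1 k0 f0
  have iwd : Integrable ((fun u : PopUnit d => t₁ (PopUnit.cov u) - t₂ (PopUnit.cov u)) *
      fun u => PopUnit.y1 u - PopUnit.y0 u) pop := by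
    refine (iw1.sub iw0).congr (ae_of_all _ fun u => ?_)
    simp only [Pi.sub_apply, Pi.mul_apply]
    ring
  have hpull := condExp_mul_of_stronglyMeasurable_left (m := sigmaX d) (μ := pop)
    (f := fun u : PopUnit d => t₁ (PopUnit.cov u) - t₂ (PopUnit.cov u))
    (g := fun u => PopUnit.y1 u - PopUnit.y0 u)
    ((hw.comp measurable_sigmaX_cov).stronglyMeasurable) iwd (hy1.sub hy0)
  have iτ : Integrable (fun u => (t₁ (PopUnit.cov u) - t₂ (PopUnit.cov u)) * cate pop u) pop :=
    integrable_condExp.congr hpull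
  have eτ : ∫ u, (t₁ (PopUnit.cov u) - t₂ (PopUnit.cov u)) * cate pop u ∂pop =
      ∫ u, (t₁ (PopUnit.cov u) - t₂ (PopUnit.cov u)) * PopUnit.y1 u ∂pop -
        ∫ u, (t₁ (PopUnit.cov u) - t₂ (PopUnit.cov u)) * PopUnit.y0 u ∂pop := by
    have h1 := integral_condExp (sigmaX_le d) (μ := pop)
      (f := (fun u : PopUnit d => t₁ (PopUnit.cov u) - t₂ (PopUnit.cov u)) *
        fun u => PopUnit.y1 u - PopUnit.y0 u)
    rw [integral_congr_ae hpull] at h1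
    rw [← integral_sub iw1 iw0]
    refine h1.trans (integral_congr_ae (ae_of_all _ fun u => ?_))
    simp only [Pi.mul_apply]
    ring
  -- The two integrals are merged before expanding: the squares of the candidates are not assumed
  -- integrable, but they cancel pointwise.
  have hdiff : ∫ u, phiModel t₁ t₂ Φ γ β₀ β₁ (PopUnit.obs u) ∂pop - relError pop t₁ t₂ =
      ∫ u, (phiModel t₁ t₂ Φ γ β₀ β₁ (PopUnit.obs u) -
        ((t₁ (PopUnit.cov u) - cate pop u) ^ 2 - (t₂ (PopUnit.cov u) - cate pop u) ^ 2)) ∂pop := by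
    rw [relError, absError, absError, ← integral_sub h_abs₁ h_abs₂]
    exact (integral_sub hphi (h_abs₁.sub h_abs₂)).symm
  rw [← sub_eq_zero, hdiff]
  have hpt : ∀ u : PopUnit d, phiModel t₁ t₂ Φ γ β₀ β₁ (PopUnit.obs u) -
      ((t₁ (PopUnit.cov u) - cate pop u) ^ 2 - (t₂ (PopUnit.cov u) - cate pop u) ^ 2) =
      2 * ((t₁ (PopUnit.cov u) - t₂ (PopUnit.cov u)) * cate pop u -
        PopUnit.treat u / psModel Φ γ (PopUnit.cov u) *
          ((t₁ (PopUnit.cov u) - t₂ (PopUnit.cov u)) * PopUnit.y1 u) +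
        (1 - PopUnit.treat u) / (1 - psModel Φ γ (PopUnit.cov u)) *
          ((t₁ (PopUnit.cov u) - t₂ (PopUnit.cov u)) * PopUnit.y0 u) -
        (1 - PopUnit.treat u / psModel Φ γ (PopUnit.cov u)) *
          ((t₁ (PopUnit.cov u) - t₂ (PopUnit.cov u)) * lin Φ β₁ (PopUnit.cov u)) +
        (1 - (1 - PopUnit.treat u) / (1 - psModel Φ γ (PopUnit.cov u))) *
          ((t₁ (PopUnit.cov u) - t₂ (PopUnit.cov u)) * lin Φ β₀ (PopUnit.cov u))) := fun u => by
    have a1 := treat_mul_outcome u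
    have a0 := one_sub_treat_mul_outcome u
    simp only [phiModel, phi, orModel, PopUnit.obs, mul_sub (PopUnit.treat u),
      mul_sub (1 - PopUnit.treat u), a1, a0]
    ring
  simp only [hpt]
  have s1 := integral_add (((iτ.sub iY1).add iY0).sub k1) k0
  have s2 := integral_sub ((iτ.sub iY1).add iY0) k1
  have s3 := integral_add (iτ.sub iY1) iY0
  have s4 := integral_sub iτ iY1
  simp only [Pi.add_apply, Pi.sub_apply] at s1 s2 s3 s4
  rw [integral_const_mul, s1, s2, s3, s4, f1, f0, e1, e0, eτ]
  ring

end Population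

/-! ### First-order conditions of the weighted least-squares loss. -/

section WLS

variable {d m : ℕ} {Φ : Vec d → Vec m} {t₁ t₂ : Vec d → ℝ} {n : ℕ} {z : ℕ → Obs d}

theorem differentiable_lin (x : Vec d) : Differentiable ℝ fun b : Vec m => lin Φ b x := by
  unfold lin
  fun_prop

theorem differentiable_wlsLoss (γ : Vec m) :
    Differentiable ℝ fun b : Vec m × Vec m => wlsLoss t₁ t₂ Φ n z γ b.1 b.2 := by
  have h0 : ∀ x, Differentiable ℝ fun b : Vec m × Vec m => lin Φ b.1 x := fun x =>
    (differentiable_lin x).comp differentiable_fst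
  have h1 : ∀ x, Differentiable ℝ fun b : Vec m × Vec m => lin Φ b.2 x := fun x =>
    (differentiable_lin x).comp differentiable_snd
  unfold wlsLoss empMean
  fun_prop

theorem lin_add_smul (b v : Vec m) (s : ℝ) (x : Vec d) :
    lin Φ (b + s • v) x = lin Φ b x + s * lin Φ v x := by
  simp only [lin, PiLp.add_apply, PiLp.smul_apply, smul_eq_mul, mul_add, Finset.sum_add_distrib,
    Finset.mul_sum]
  congr 1
  exact Finset.sum_congr rfl fun j _ => by ring

theorem hasDerivAt_sq_sub_mul (c u : ℝ) :
    HasDerivAt (fun s : ℝ => (c - s * u) ^ 2) (-(2 * (c * u))) 0 := by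
  have h := (((hasDerivAt_id (0 : ℝ)).mul_const u).const_sub c).pow 2
  refine h.congr_deriv ?_
  simp
  ring

/-- The loss is quadratic along each line, so it is differentiated there term by term. The odds `e /
(1 - e)` and `(1 - e) / e` are `exp (± Φᵀγ)`, precisely the weights in the γ-derivative of
`phiModel`. -/
theorem fderiv_wlsLoss_apply (γ β₀ β₁ v₀ v₁ : Vec m) :
    fderiv ℝ (fun b : Vec m × Vec m => wlsLoss t₁ t₂ Φ n z γ b.1 b.2) (β₀, β₁) (v₀, v₁) =
      -2 * empMean n z fun o => (t₁ o.2.1 - t₂ o.2.1) *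
        ((1 - o.1) * Real.exp (lin Φ γ o.2.1) * ((o.2.2 - lin Φ β₀ o.2.1) * lin Φ v₀ o.2.1) +
          o.1 * Real.exp (-lin Φ γ o.2.1) * ((o.2.2 - lin Φ β₁ o.2.1) * lin Φ v₁ o.2.1)) := by
  have hline : HasDerivAt (fun s : ℝ => (β₀, β₁) + s • (v₀, v₁)) (v₀, v₁) 0 := by
    simpa using ((hasDerivAt_id (0 : ℝ)).smul_const (v₀, v₁)).const_add (β₀, β₁)
  have hf : HasFDerivAt (fun b : Vec m × Vec m => wlsLoss t₁ t₂ Φ n z γ b.1 b.2)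
      (fderiv ℝ (fun b : Vec m × Vec m => wlsLoss t₁ t₂ Φ n z γ b.1 b.2) (β₀, β₁))
      ((β₀, β₁) + (0 : ℝ) • (v₀, v₁)) := by
    rw [zero_smul, add_zero]
    exact (differentiable_wlsLoss γ _).hasFDerivAt
  have h1 := hf.comp_hasDerivAt (0 : ℝ) hline
  refine h1.unique ?_
  have hterm : ∀ o : Obs d, HasDerivAt (fun s : ℝ => (t₁ o.2.1 - t₂ o.2.1) *
      ((1 - o.1) * psModel Φ γ o.2.1 * (o.2.2 - lin Φ (β₀ + s • v₀) o.2.1) ^ 2 /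
          (1 - psModel Φ γ o.2.1) +
        o.1 * (1 - psModel Φ γ o.2.1) * (o.2.2 - lin Φ (β₁ + s • v₁) o.2.1) ^ 2 /
          psModel Φ γ o.2.1))
      (-2 * ((t₁ o.2.1 - t₂ o.2.1) *
        ((1 - o.1) * Real.exp (lin Φ γ o.2.1) * ((o.2.2 - lin Φ β₀ o.2.1) * lin Φ v₀ o.2.1) +
          o.1 * Real.exp (-lin Φ γ o.2.1) *
            ((o.2.2 - lin Φ β₁ o.2.1) * lin Φ v₁ o.2.1)))) 0 := by
    intro o
    rw [← psModel_div_one_sub, ← one_sub_psModel_div]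
    simp only [lin_add_smul, ← sub_sub]
    have a := (((hasDerivAt_sq_sub_mul (o.2.2 - lin Φ β₀ o.2.1) (lin Φ v₀ o.2.1)).const_mul
      ((1 - o.1) * psModel Φ γ o.2.1)).div_const (1 - psModel Φ γ o.2.1)).add
      (((hasDerivAt_sq_sub_mul (o.2.2 - lin Φ β₁ o.2.1) (lin Φ v₁ o.2.1)).const_mul
      (o.1 * (1 - psModel Φ γ o.2.1))).div_const (psModel Φ γ o.2.1))
    refine (a.const_mul (t₁ o.2.1 - t₂ o.2.1)).congr_deriv ?_
    ring
  have hsum := (HasDerivAt.fun_sum (u := Finset.range n) fun i _ => hterm (z i)).const_mul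
    (1 / (n : ℝ))
  refine hsum.congr_deriv ?_
  rw [← empMean_const_mul]
  rfl

theorem lin_single (j : Fin m) (x : Vec d) :
    lin Φ (EuclideanSpace.single j (1 : ℝ)) x = Φ x j := by
  simp [lin]

theorem lin_zero (x : Vec d) : lin Φ (0 : Vec m) x = 0 := by
  simp [lin]

/-- This links the two estimation steps: a small gradient of the loss makes the empirical γ-scores
small. -/
theorem empMean_treatedScore_eq (γ β₀ β₁ : Vec m) (j : Fin m) :
    empMean n z (treatedScore Φ t₁ t₂ γ β₁ j) =
      (-1 / 2) * fderiv ℝ (fun b : Vec m × Vec m => wlsLoss t₁ t₂ Φ n z γ b.1 b.2) (β₀, β₁)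
        (0, EuclideanSpace.single j 1) := by
  rw [fderiv_wlsLoss_apply, ← mul_assoc]
  norm_num
  congr 1
  ext o
  rw [lin_single, lin_zero]
  unfold treatedScore
  ring

theorem empMean_controlScore_eq (γ β₀ β₁ : Vec m) (j : Fin m) :
    empMean n z (controlScore Φ t₁ t₂ γ β₀ j) =
      (-1 / 2) * fderiv ℝ (fun b : Vec m × Vec m => wlsLoss t₁ t₂ Φ n z γ b.1 b.2) (β₀, β₁)
        (EuclideanSpace.single j 1, 0) := by
  rw [fderiv_wlsLoss_apply, ← mul_assoc]
  norm_num
  congr 1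
  ext o
  rw [lin_single, lin_zero]
  unfold controlScore
  ring

end WLS

/-! ### Empirical means at converging parameters. -/

section Limits

variable {d m : ℕ} {Φ : Vec d → Vec m} {t₁ t₂ : Vec d → ℝ} {z : ℕ → Obs d} {ns : ℕ → ℕ}

/-- A substitute for a uniform law of large numbers: the data-dependent integrand differs from a
fixed one by a vanishing multiple of a fixed function with convergent means. -/
theorem tendsto_empMean_of_abs_sub_le {f : ℕ → Obs d → ℝ} {g G : Obs d → ℝ} {c : ℕ → ℝ}
    {L L' : ℝ} (hg : Tendsto (fun k => empMean (ns k) z g) atTop (𝓝 L))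
    (hG : Tendsto (fun k => empMean (ns k) z G) atTop (𝓝 L'))
    (hc : Tendsto c atTop (𝓝 0))
    (hle : ∀ᶠ k in atTop, ∀ i, |f k (z i) - g (z i)| ≤ c k * G (z i)) :
    Tendsto (fun k => empMean (ns k) z (f k)) atTop (𝓝 L) := by
  have h0 : Tendsto (fun k => empMean (ns k) z (f k) - empMean (ns k) z g) atTop (𝓝 0) := by
    refine squeeze_zero_norm' ?_ (by simpa using hc.mul hG)
    filter_upwards [hle] with k hk
    exact abs_empMean_sub_le hk
  simpa using h0.add hg

end Limits

/-! ### Passing to almost surely convergent subsequences. -/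

section InProbability

variable {Ω : Type*} [MeasurableSpace Ω] {P : Measure Ω} {m : ℕ}

/-- The sum of the norms tends to 0 in probability, so one subsequence serves the whole finite
family. -/
theorem exists_seq_ae_tendsto_zero {ι : Type*} [Fintype ι] {X : ι → ℕ → Ω → ℝ}
    (hX : ∀ i, TendstoInMeasure P (X i) atTop (fun _ => 0)) {ns : ℕ → ℕ} (hns : StrictMono ns) :
    ∃ ns' : ℕ → ℕ, StrictMono ns' ∧
      ∀ᵐ ω ∂P, ∀ i, Tendsto (fun k => X i (ns (ns' k)) ω) atTop (𝓝 0) := by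
  obtain ⟨ns', hns', h⟩ := ((tendstoInMeasure_sum_norm Finset.univ hX).comp
    hns.tendsto_atTop).exists_seq_tendsto_ae
  refine ⟨ns', hns', ?_⟩
  filter_upwards [h] with ω hω i
  refine squeeze_zero_norm (fun k => ?_) hω
  exact Finset.single_le_sum (f := fun i => ‖X i (ns (ns' k)) ω‖) (fun _ _ => norm_nonneg _)
    (Finset.mem_univ i)

theorem norm_le_norm_rpow_smul {E : Type*} [NormedAddCommGroup E] [NormedSpace ℝ E] {n : ℕ}
    (hn : 1 ≤ n) (v : E) : ‖v‖ ≤ ‖((n : ℝ) ^ (1 / 4 : ℝ)) • v‖ := by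
  rw [norm_smul]
  refine le_mul_of_one_le_left (norm_nonneg _) ?_
  rw [Real.norm_of_nonneg (by positivity)]
  exact Real.one_le_rpow (by exact_mod_cast hn) (by norm_num)

end InProbability

/-! ### Strong law for functions of the observations. -/

section Identification

variable {d m : ℕ} {pop : Measure (PopUnit d)}
  {Φ : Vec d → Vec m} {t₁ t₂ : Vec d → ℝ} {Ω : Type*} [MeasurableSpace Ω] {P : Measure Ω}
  {U : ℕ → Ω → PopUnit d}

theorem ae_tendsto_empMean (hU_law : ∀ i, HasLaw (U i) pop P) (hU_indep : iIndepFun U P)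
    {f : Obs d → ℝ} (hf : Measurable f) (hint : Integrable (fun u => f (PopUnit.obs u)) pop) :
    ∀ᵐ ω ∂P, Tendsto (fun n : ℕ => empMean n (fun i => PopUnit.obs (U i ω)) f) atTop
      (𝓝 (∫ u, f (PopUnit.obs u) ∂pop)) :=
  ae_tendsto_mean hU_law hU_indep (hf.comp measurable_obs) hint

end Identification

/-! ### Limits of the nuisance estimators and negligibility of their estimation error. -/

section Asymptotics

variable {d m : ℕ} {pop : Measure (PopUnit d)}
  {Φ : Vec d → Vec m} {t₁ t₂ : Vec d → ℝ} {Ω : Type*} [MeasurableSpace Ω] {P : Measure Ω}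
  {U : ℕ → Ω → PopUnit d} {γhat β₀hat β₁hat : ℕ → Ω → Vec m}
  {γbar β₀bar β₁bar : Vec m}

theorem aemeasurable_relErrorEst (ht₁ : Measurable t₁) (ht₂ : Measurable t₂) (hΦ : Measurable Φ)
    (hU_law : ∀ i, HasLaw (U i) pop P) {γ β₀ β₁ : Ω → Vec m} (hγ : AEMeasurable γ P)
    (hβ₀ : AEMeasurable β₀ P) (hβ₁ : AEMeasurable β₁ P) (n : ℕ) :
    AEMeasurable (fun ω => relErrorEst t₁ t₂ Φ n (fun i => PopUnit.obs (U i ω))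
      (γ ω) (β₀ ω) (β₁ ω)) P := by
  unfold relErrorEst empMean
  refine (Finset.aemeasurable_fun_sum _ fun i _ => ?_).const_mul _
  have hU := (hU_law i).aemeasurable
  refine ⟨fun ω => phiModel t₁ t₂ Φ (hγ.mk γ ω) (hβ₀.mk β₀ ω) (hβ₁.mk β₁ ω)
    (PopUnit.obs (hU.mk (U i) ω)), measurable_phiModel ht₁ ht₂ hΦ hγ.measurable_mk
      hβ₀.measurable_mk hβ₁.measurable_mk (measurable_obs.comp hU.measurable_mk), ?_⟩
  filter_upwards [hγ.ae_eq_mk, hβ₀.ae_eq_mk, hβ₁.ae_eq_mk, hU.ae_eq_mk] with ω h1 h2 h3 h4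
  rw [h1, h2, h3, h4]

theorem empMean_phiLinear (n : ℕ) (z : ℕ → Obs d) (v v₀ v₁ : Vec m) :
    empMean n z (phiLinear Φ t₁ t₂ γbar β₀bar β₁bar v v₀ v₁) =
      2 * (∑ j, v j * empMean n z (treatedScore Φ t₁ t₂ γbar β₁bar j) +
        ∑ j, v j * empMean n z (controlScore Φ t₁ t₂ γbar β₀bar j) +
        ∑ j, v₀ j * empMean n z (controlBalance Φ t₁ t₂ γbar j) -
        ∑ j, v₁ j * empMean n z (treatedBalance Φ t₁ t₂ γbar j)) := by
  unfold phiLinear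
  simp only [empMean_const_mul, empMean_sub, empMean_add, empMean_sum]

/-- The factor `q ^ 2` is split evenly, one `q` for the parameter error and one for the empirical
mean; with `q = n^{1/4}` this is where the quarter rates are used in the linear term. -/
theorem tendsto_mul_sum_mul_zero {q : ℕ → ℝ} {v : ℕ → Vec m} {M : ℕ → Fin m → ℝ}
    (hv : Tendsto (fun k => ‖q k • v k‖) atTop (𝓝 0))
    (hM : ∀ j, Tendsto (fun k => q k * M k j) atTop (𝓝 0)) :
    Tendsto (fun k => q k ^ 2 * ∑ j, v k j * M k j) atTop (𝓝 0) := by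
  have h : ∀ j, Tendsto (fun k => (q k * v k j) * (q k * M k j)) atTop (𝓝 0) := fun j => by
    have h1 : Tendsto (fun k => q k * v k j) atTop (𝓝 0) :=
      squeeze_zero_norm (fun k => by
        simpa using abs_coord_le (q k • v k) j) hv
    simpa using h1.mul (hM j)
  have h2 := tendsto_finsetSum (Finset.univ : Finset (Fin m)) fun j _ => h j
  rw [Finset.sum_const_zero] at h2
  refine h2.congr fun k => ?_
  rw [Finset.mul_sum]
  exact Finset.sum_congr rfl fun j _ => by ring

variable [IsProbabilityMeasure pop] [IsProbabilityMeasure P]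

/-- The limits of the nuisance estimators: the limiting propensity score is the true one, and the
limiting outcome regressions solve the weighted normal equations. -/
theorem nuisance_limits (h_unconf : Unconfounded pop) (ht₁ : Measurable t₁) (ht₂ : Measurable t₂)
    (hΦ : Measurable Φ) (hΦ_int : Integrable (fun u => Φ (PopUnit.cov u)) pop)
    (h_ps : PSCorrect pop Φ) (hU_law : ∀ i, HasLaw (U i) pop P) (hU_indep : iIndepFun U P)
    {c : ℝ} (hc : 0 ≤ c)
    (h_bal : SolvesBalance P t₁ t₂ Φ c (fun ω i => PopUnit.obs (U i ω)) γhat)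
    (h_wls : SolvesWLS P t₁ t₂ Φ (fun ω i => PopUnit.obs (U i ω)) γhat β₀hat β₁hat)
    (hγ_rate : FasterThanQuarterRate P γhat γbar)
    (hβ₀_rate : FasterThanQuarterRate P β₀hat β₀bar)
    (hβ₁_rate : FasterThanQuarterRate P β₁hat β₁bar) {r : ℝ} (hr : 0 < r)
    (henv : MemLp (fun u => envelope t₁ t₂ Φ γbar r (PopUnit.obs u)) 2 pop) :
    (propensity pop =ᵐ[pop] fun u => psModel Φ γbar (PopUnit.cov u)) ∧
    (∀ j, ∫ u, treatedScore Φ t₁ t₂ γbar β₁bar j (PopUnit.obs u) ∂pop = 0) ∧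
    (∀ j, ∫ u, controlScore Φ t₁ t₂ γbar β₀bar j (PopUnit.obs u) ∂pop = 0) := by
  obtain ⟨γs, hps⟩ := h_ps
  obtain ⟨ξ, η, err, herr, hsol⟩ := h_bal
  have iΦ := integrable_diff_mul_coord hΦ ht₁ ht₂ hr henv
  have hT := fun j => integral_treatedBalance h_unconf hΦ ht₁ ht₂ hps j (iΦ j)
  have hC := fun j => integral_controlBalance h_unconf hΦ ht₁ ht₂ hps j (iΦ j)
  have l1 := ae_tendsto_empMean hU_law hU_indep (measurable_logLik hΦ γs)
    (integrable_logLik hΦ hΦ_int γs)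
  have l2 := ae_tendsto_empMean hU_law hU_indep (measurable_logLik hΦ γbar)
    (integrable_logLik hΦ hΦ_int γbar)
  have l3 := ae_tendsto_empMean hU_law hU_indep (f := fun o => ‖Φ o.2.1‖) (by fun_prop)
    hΦ_int.norm
  have l4 := ae_all_iff.2 fun j => ae_tendsto_empMean hU_law hU_indep
    (measurable_treatedBalance ht₁ ht₂ hΦ γs j) (hT j).1
  have l5 := ae_all_iff.2 fun j => ae_tendsto_empMean hU_law hU_indep
    (measurable_controlBalance ht₁ ht₂ hΦ γs j) (hC j).1
  have l6 := ae_all_iff.2 fun j => ae_tendsto_empMean hU_law hU_indep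
    (measurable_treatedScore ht₁ ht₂ hΦ γbar β₁bar j)
    ((memLp_of_abs_le_mul_envelope (measurable_treatedScore ht₁ ht₂ hΦ γbar β₁bar j) henv
      fun o ho => abs_treatedScore_le hr ho j).integrable one_le_two)
  have l7 := ae_all_iff.2 fun j => ae_tendsto_empMean hU_law hU_indep
    (measurable_controlScore ht₁ ht₂ hΦ γbar β₀bar j)
    ((memLp_of_abs_le_mul_envelope (measurable_controlScore ht₁ ht₂ hΦ γbar β₀bar j) henv
      fun o ho => abs_controlScore_le hr ho j).integrable one_le_two)
  have l8 := ae_tendsto_empMean hU_law hU_indep (measurable_envelope ht₁ ht₂ hΦ γbar r)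
    (henv.integrable one_le_two)
  obtain ⟨ns, hns, hX⟩ := exists_seq_ae_tendsto_zero (ι := Fin 5) (P := P)
    (X := ![fun n ω => ‖((n : ℝ) ^ (1 / 4 : ℝ)) • (γhat n ω - γbar)‖,
      fun n ω => ‖((n : ℝ) ^ (1 / 4 : ℝ)) • (β₀hat n ω - β₀bar)‖,
      fun n ω => ‖((n : ℝ) ^ (1 / 4 : ℝ)) • (β₁hat n ω - β₁bar)‖, err,
      fun n ω => ‖fderiv ℝ (fun b : Vec m × Vec m => wlsLoss t₁ t₂ Φ n
        (fun i => PopUnit.obs (U i ω)) (γhat n ω) b.1 b.2) (β₀hat n ω, β₁hat n ω)‖])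
    (by
      intro i
      fin_cases i
      · exact tendstoInMeasure_norm_zero hγ_rate
      · exact tendstoInMeasure_norm_zero hβ₀_rate
      · exact tendstoInMeasure_norm_zero hβ₁_rate
      · exact herr
      · exact tendstoInMeasure_norm_zero h_wls) strictMono_id
  -- The conclusions are deterministic, so a single sample path on which all the limits hold is
  -- enough.
  obtain ⟨ω, hω, l1, l2, l3, l4, l5, l6, l7, l8⟩ := (hX.and (l1.and (l2.and (l3.and (l4.and
    (l5.and (l6.and (l7.and l8)))))))).exists
  have hn : Tendsto ns atTop atTop := hns.tendsto_atTop
  have hn1 : ∀ᶠ k in atTop, 1 ≤ ns k := hn.eventually_ge_atTop 1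
  have hγ : Tendsto (fun k => ‖γhat (ns k) ω - γbar‖) atTop (𝓝 0) := by
    refine squeeze_zero_norm' ?_ (hω 0)
    filter_upwards [hn1] with k hk
    rw [norm_norm]; exact norm_le_norm_rpow_smul hk _
  have hβ₀ : Tendsto (fun k => ‖β₀hat (ns k) ω - β₀bar‖) atTop (𝓝 0) := by
    refine squeeze_zero_norm' ?_ (hω 1)
    filter_upwards [hn1] with k hk
    rw [norm_norm]; exact norm_le_norm_rpow_smul hk _
  have hβ₁ : Tendsto (fun k => ‖β₁hat (ns k) ω - β₁bar‖) atTop (𝓝 0) := by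
    refine squeeze_zero_norm' ?_ (hω 2)
    filter_upwards [hn1] with k hk
    rw [norm_norm]; exact norm_le_norm_rpow_smul hk _
  have herr' : Tendsto (fun k => err (ns k) ω) atTop (𝓝 0) := hω 3
  have hder : Tendsto (fun k => ‖fderiv ℝ (fun b : Vec m × Vec m => wlsLoss t₁ t₂ Φ (ns k)
      (fun i => PopUnit.obs (U i ω)) (γhat (ns k) ω) b.1 b.2)
      (β₀hat (ns k) ω, β₁hat (ns k) ω)‖) atTop (𝓝 0) := hω 4
  set z : ℕ → Obs d := fun i => PopUnit.obs (U i ω) with hz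
  have hz01 : ∀ i, (z i).1 = 0 ∨ (z i).1 = 1 := fun i => treat_eq (U i ω)
  have hγr : ∀ᶠ k in atTop, ‖γhat (ns k) ω - γbar‖ ≤ r / 2 :=
    hγ.eventually_le_const (by positivity)
  refine ⟨psModel_ae_eq_of_integral_logLik_le h_unconf hΦ hΦ_int hps ?_, fun j => ?_, fun j => ?_⟩
  · have hhat : Tendsto (fun k => empMean (ns k) z (logLik Φ (γhat (ns k) ω))) atTop
        (𝓝 (∫ u, logLik Φ γbar (PopUnit.obs u) ∂pop)) :=
      tendsto_empMean_of_abs_sub_le (f := fun k => logLik Φ (γhat (ns k) ω))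
        (G := fun o => ‖Φ o.2.1‖) (c := fun k => ‖γhat (ns k) ω - γbar‖) (l2.comp hn) (l3.comp hn) hγ
        (Eventually.of_forall fun k i => abs_logLik_sub_le (hz01 i))
    have hslack : Tendsto (fun k => ∑ j, (|empMean (ns k) z (treatedBalance Φ t₁ t₂ γs j)| +
        |empMean (ns k) z (controlBalance Φ t₁ t₂ γs j)|)) atTop (𝓝 0) := by
      have := tendsto_finsetSum (Finset.univ : Finset (Fin m)) fun j _ =>
        (((l4 j).comp hn).abs).add (((l5 j).comp hn).abs)
      simpa only [(hT _).2, (hC _).2, abs_zero, add_zero, Finset.sum_const_zero, Function.comp] using this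
    have hrhs := ((l1.comp hn).neg.add (hslack.const_mul c)).add herr'
    rw [mul_zero, add_zero, add_zero] at hrhs
    refine neg_le_neg_iff.1 (le_of_tendsto_of_tendsto' hhat.neg hrhs fun k => ?_)
    obtain ⟨hf, hmin⟩ := hsol (ns k) ω
    -- The competitor is a true parameter with the smallest feasible slacks, namely its absolute
    -- empirical imbalances, which tend to 0.
    have h1 := hmin γs
      (WithLp.toLp 2 fun j => |empMean (ns k) z (treatedBalance Φ t₁ t₂ γs j)|)
      (WithLp.toLp 2 fun j => |empMean (ns k) z (controlBalance Φ t₁ t₂ γs j)|)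
      ⟨fun j => le_rfl, fun j => le_rfl, fun j => abs_nonneg _, fun j => abs_nonneg _⟩
    -- The penalty at the estimator is nonnegative and can be dropped; its size is never needed.
    have h2 : 0 ≤ c * ∑ j, (ξ (ns k) ω j + η (ns k) ω j) :=
      mul_nonneg hc (Finset.sum_nonneg fun j _ =>
        add_nonneg (hf.slack_treated_nonneg j) (hf.slack_control_nonneg j))
    have h3 : balanceObjective Φ c (ns k) z (γhat (ns k) ω) (ξ (ns k) ω) (η (ns k) ω) =
        -empMean (ns k) z (logLik Φ (γhat (ns k) ω)) +
          c * ∑ j, (ξ (ns k) ω j + η (ns k) ω j) := rfl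
    rw [h3] at h1
    refine le_trans ?_ h1
    linarith
  · have hlim : Tendsto (fun k => empMean (ns k) z
        (treatedScore Φ t₁ t₂ (γhat (ns k) ω) (β₁hat (ns k) ω) j)) atTop
        (𝓝 (∫ u, treatedScore Φ t₁ t₂ γbar β₁bar j (PopUnit.obs u) ∂pop)) := by
      refine tendsto_empMean_of_abs_sub_le ((l6 j).comp hn) (l8.comp hn)
        (c := fun k => (2 + ‖β₁bar‖) * (‖γhat (ns k) ω - γbar‖ + ‖β₁hat (ns k) ω - β₁bar‖) *
          (1 + 2 / r + 8 / r ^ 2))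
        (by simpa using ((hγ.add hβ₁).const_mul (2 + ‖β₁bar‖)).mul_const (1 + 2 / r + 8 / r ^ 2)) ?_
      filter_upwards [hγr] with k hk i
      exact abs_treatedScore_sub_le hr (hz01 i) j hk
    -- The empirical score tends to its expectation, and also to 0 because it is bounded by the
    -- gradient of the loss.
    refine tendsto_nhds_unique hlim (squeeze_zero_norm (fun k => ?_) hder)
    rw [empMean_treatedScore_eq _ (β₀hat (ns k) ω), norm_mul]
    refine (mul_le_of_le_one_left (norm_nonneg _) (by norm_num)).trans ?_
    exact (ContinuousLinearMap.le_opNorm _ _).trans_eq (by simp)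
  · have hlim : Tendsto (fun k => empMean (ns k) z
        (controlScore Φ t₁ t₂ (γhat (ns k) ω) (β₀hat (ns k) ω) j)) atTop
        (𝓝 (∫ u, controlScore Φ t₁ t₂ γbar β₀bar j (PopUnit.obs u) ∂pop)) := by
      refine tendsto_empMean_of_abs_sub_le ((l7 j).comp hn) (l8.comp hn)
        (c := fun k => (2 + ‖β₀bar‖) * (‖γhat (ns k) ω - γbar‖ + ‖β₀hat (ns k) ω - β₀bar‖) *
          (1 + 2 / r + 8 / r ^ 2))
        (by simpa using ((hγ.add hβ₀).const_mul (2 + ‖β₀bar‖)).mul_const (1 + 2 / r + 8 / r ^ 2)) ?_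
      filter_upwards [hγr] with k hk i
      exact abs_controlScore_sub_le hr (hz01 i) j hk
    refine tendsto_nhds_unique hlim (squeeze_zero_norm (fun k => ?_) hder)
    rw [empMean_controlScore_eq _ _ (β₁hat (ns k) ω), norm_mul]
    refine (mul_le_of_le_one_left (norm_nonneg _) (by norm_num)).trans ?_
    exact (ContinuousLinearMap.le_opNorm _ _).trans_eq (by simp)

/-- The estimation of the nuisance parameters has no first-order effect on the estimated relative
error. -/
theorem tendstoInMeasure_sqrt_mul_relErrorEst_sub (h_unconf : Unconfounded pop)
    (ht₁ : Measurable t₁) (ht₂ : Measurable t₂) (hΦ : Measurable Φ)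
    (hU_law : ∀ i, HasLaw (U i) pop P) (hU_indep : iIndepFun U P)
    (hγ_meas : ∀ n, AEMeasurable (γhat n) P) (hβ₀_meas : ∀ n, AEMeasurable (β₀hat n) P)
    (hβ₁_meas : ∀ n, AEMeasurable (β₁hat n) P)
    (hγ_rate : FasterThanQuarterRate P γhat γbar)
    (hβ₀_rate : FasterThanQuarterRate P β₀hat β₀bar)
    (hβ₁_rate : FasterThanQuarterRate P β₁hat β₁bar) {r : ℝ} (hr : 0 < r)
    (henv : MemLp (fun u => envelope t₁ t₂ Φ γbar r (PopUnit.obs u)) 2 pop)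
    (hps : propensity pop =ᵐ[pop] fun u => psModel Φ γbar (PopUnit.cov u))
    (hts : ∀ j, ∫ u, treatedScore Φ t₁ t₂ γbar β₁bar j (PopUnit.obs u) ∂pop = 0)
    (hcs : ∀ j, ∫ u, controlScore Φ t₁ t₂ γbar β₀bar j (PopUnit.obs u) ∂pop = 0) :
    TendstoInMeasure P (fun (n : ℕ) ω => Real.sqrt n *
      (relErrorEst t₁ t₂ Φ n (fun i => PopUnit.obs (U i ω)) (γhat n ω) (β₀hat n ω) (β₁hat n ω) -
        relErrorEst t₁ t₂ Φ n (fun i => PopUnit.obs (U i ω)) γbar β₀bar β₁bar))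
      atTop (fun _ => 0) := by
  have iΦ := integrable_diff_mul_coord hΦ ht₁ ht₂ hr henv
  have quarter : ∀ {f : Obs d → ℝ}, Measurable f →
      MemLp (fun u => f (PopUnit.obs u)) 2 pop → ∫ u, f (PopUnit.obs u) ∂pop = 0 →
      TendstoInMeasure P (fun (n : ℕ) ω => (n : ℝ) ^ (1 / 4 : ℝ) *
        empMean n (fun i => PopUnit.obs (U i ω)) f) atTop (fun _ => 0) := fun {g} hf hL h0 =>
    tendstoInMeasure_rpow_mul_mean (f := fun u => g (PopUnit.obs u)) hU_law hU_indep (hf.comp measurable_obs) hL h0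
  have q1 := fun j => quarter (measurable_treatedScore ht₁ ht₂ hΦ γbar β₁bar j)
    (memLp_of_abs_le_mul_envelope (measurable_treatedScore ht₁ ht₂ hΦ γbar β₁bar j) henv
      fun o ho => abs_treatedScore_le hr ho j) (hts j)
  have q2 := fun j => quarter (measurable_controlScore ht₁ ht₂ hΦ γbar β₀bar j)
    (memLp_of_abs_le_mul_envelope (measurable_controlScore ht₁ ht₂ hΦ γbar β₀bar j) henv
      fun o ho => abs_controlScore_le hr ho j) (hcs j)
  have q3 := fun j => quarter (measurable_treatedBalance ht₁ ht₂ hΦ γbar j)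
    (memLp_of_abs_le_mul_envelope (K := 1) (measurable_treatedBalance ht₁ ht₂ hΦ γbar j) henv
      fun o ho => by
        rw [one_mul]; exact (abs_treatedBalance_le ho j).trans (baseEnvelope_le_envelope hr ho))
    (integral_treatedBalance h_unconf hΦ ht₁ ht₂ hps j (iΦ j)).2
  have q4 := fun j => quarter (measurable_controlBalance ht₁ ht₂ hΦ γbar j)
    (memLp_of_abs_le_mul_envelope (K := 1) (measurable_controlBalance ht₁ ht₂ hΦ γbar j) henv
      fun o ho => by
        rw [one_mul]; exact (abs_controlBalance_le ho j).trans (baseEnvelope_le_envelope hr ho))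
    (integral_controlBalance h_unconf hΦ ht₁ ht₂ hps j (iΦ j)).2
  have l8 := ae_tendsto_empMean hU_law hU_indep (measurable_envelope ht₁ ht₂ hΦ γbar r)
    (henv.integrable one_le_two)
  -- Convergence in probability is checked along subsequences, which turns the stochastic orders
  -- into pathwise limits.
  refine (exists_seq_tendstoInMeasure_atTop_iff fun n => AEMeasurable.aestronglyMeasurable
    (((aemeasurable_relErrorEst ht₁ ht₂ hΦ hU_law (hγ_meas n) (hβ₀_meas n) (hβ₁_meas n) n).sub
      (aemeasurable_relErrorEst ht₁ ht₂ hΦ hU_law aemeasurable_const aemeasurable_const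
        aemeasurable_const n)).const_mul _)).2 fun ns hns => ?_
  obtain ⟨ns', hns', hX⟩ := exists_seq_ae_tendsto_zero (ι := Fin 3 ⊕ Fin 4 × Fin m) (P := P)
    (X := Sum.elim
      ![fun n ω => ‖((n : ℝ) ^ (1 / 4 : ℝ)) • (γhat n ω - γbar)‖,
        fun n ω => ‖((n : ℝ) ^ (1 / 4 : ℝ)) • (β₀hat n ω - β₀bar)‖,
        fun n ω => ‖((n : ℝ) ^ (1 / 4 : ℝ)) • (β₁hat n ω - β₁bar)‖]
      fun p n ω => (n : ℝ) ^ (1 / 4 : ℝ) * empMean n (fun i => PopUnit.obs (U i ω))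
        (![treatedScore Φ t₁ t₂ γbar β₁bar p.2, controlScore Φ t₁ t₂ γbar β₀bar p.2,
          treatedBalance Φ t₁ t₂ γbar p.2, controlBalance Φ t₁ t₂ γbar p.2] p.1))
    (by
      rintro (i | ⟨i, j⟩)
      · fin_cases i
        · exact tendstoInMeasure_norm_zero hγ_rate
        · exact tendstoInMeasure_norm_zero hβ₀_rate
        · exact tendstoInMeasure_norm_zero hβ₁_rate
      · fin_cases i
        · exact q1 j
        · exact q2 j
        · exact q3 j
        · exact q4 j) hns
  refine ⟨ns', hns', ?_⟩
  filter_upwards [hX, l8] with ω hω l8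
  have hn : Tendsto (fun k => ns (ns' k)) atTop atTop := (hns.comp hns').tendsto_atTop
  set z : ℕ → Obs d := fun i => PopUnit.obs (U i ω) with hz
  have hz01 : ∀ i, (z i).1 = 0 ∨ (z i).1 = 1 := fun i => treat_eq (U i ω)
  set N : ℕ → ℕ := fun k => ns (ns' k) with hN
  set q : ℕ → ℝ := fun k => (N k : ℝ) ^ (1 / 4 : ℝ) with hq
  have hq2 : ∀ k, Real.sqrt (N k) = q k ^ 2 := fun k => by
    rw [hq, ← Real.rpow_natCast, ← Real.rpow_mul (Nat.cast_nonneg _), Real.sqrt_eq_rpow]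
    norm_num
  have hq0 : ∀ k, 0 ≤ q k := fun k => by positivity
  have aγ : Tendsto (fun k => ‖q k • (γhat (N k) ω - γbar)‖) atTop (𝓝 0) := hω (Sum.inl 0)
  have aβ₀ : Tendsto (fun k => ‖q k • (β₀hat (N k) ω - β₀bar)‖) atTop (𝓝 0) := hω (Sum.inl 1)
  have aβ₁ : Tendsto (fun k => ‖q k • (β₁hat (N k) ω - β₁bar)‖) atTop (𝓝 0) := hω (Sum.inl 2)
  have hγr : ∀ᶠ k in atTop, ‖γhat (N k) ω - γbar‖ ≤ r / 2 := by
    filter_upwards [aγ.eventually_le_const (by positivity : 0 < r / 2),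
      hn.eventually_ge_atTop 1] with k h1 h2
    exact (norm_le_norm_rpow_smul h2 _).trans h1
  have hlin : Tendsto (fun k => q k ^ 2 * empMean (N k) z (phiLinear Φ t₁ t₂ γbar β₀bar β₁bar
      (γhat (N k) ω - γbar) (β₀hat (N k) ω - β₀bar) (β₁hat (N k) ω - β₁bar))) atTop (𝓝 0) := by
    have s1 := tendsto_mul_sum_mul_zero
      (M := fun k j => empMean (N k) z (treatedScore Φ t₁ t₂ γbar β₁bar j)) aγ
      fun j => hω (Sum.inr (0, j))
    have s2 := tendsto_mul_sum_mul_zero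
      (M := fun k j => empMean (N k) z (controlScore Φ t₁ t₂ γbar β₀bar j)) aγ
      fun j => hω (Sum.inr (1, j))
    have s3 := tendsto_mul_sum_mul_zero
      (M := fun k j => empMean (N k) z (controlBalance Φ t₁ t₂ γbar j)) aβ₀
      fun j => hω (Sum.inr (3, j))
    have s4 := tendsto_mul_sum_mul_zero
      (M := fun k j => empMean (N k) z (treatedBalance Φ t₁ t₂ γbar j)) aβ₁
      fun j => hω (Sum.inr (2, j))
    have s := (((s1.add s2).add s3).sub s4).const_mul 2
    simp only [add_zero, sub_zero, mul_zero] at s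
    refine s.congr fun k => ?_
    rw [empMean_phiLinear]
    ring
  set K : ℝ := 2 * ((4 + ‖β₀bar‖ + ‖β₁bar‖) * (1 + 2 / r + 8 / r ^ 2)) with hK
  have hrem : Tendsto (fun k => q k ^ 2 * (empMean (N k) z (phiModel t₁ t₂ Φ (γhat (N k) ω)
      (β₀hat (N k) ω) (β₁hat (N k) ω)) - empMean (N k) z (phiModel t₁ t₂ Φ γbar β₀bar β₁bar) -
      empMean (N k) z (phiLinear Φ t₁ t₂ γbar β₀bar β₁bar
      (γhat (N k) ω - γbar) (β₀hat (N k) ω - β₀bar) (β₁hat (N k) ω - β₁bar)))) atTop (𝓝 0) := by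
    have hb := ((((aγ.add aβ₀).add aβ₁).pow 2).const_mul K).mul (l8.comp hn)
    simp only [add_zero, ne_eq, OfNat.ofNat_ne_zero, not_false_eq_true, zero_pow, mul_zero,
      zero_mul] at hb
    refine squeeze_zero_norm' ?_ hb
    filter_upwards [hγr] with k hk
    rw [norm_mul, Real.norm_of_nonneg (by positivity), ← empMean_sub, ← empMean_sub,
      Real.norm_eq_abs]
    have h1 := abs_empMean_le (n := N k) (z := z)
      (f := fun o => phiModel t₁ t₂ Φ (γhat (N k) ω) (β₀hat (N k) ω) (β₁hat (N k) ω) o -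
        phiModel t₁ t₂ Φ γbar β₀bar β₁bar o - phiLinear Φ t₁ t₂ γbar β₀bar β₁bar
          (γhat (N k) ω - γbar) (β₀hat (N k) ω - β₀bar) (β₁hat (N k) ω - β₁bar) o)
      (G := envelope t₁ t₂ Φ γbar r) fun i =>
      abs_phiModel_sub_sub_phiLinear_le (t₁ := t₁) (t₂ := t₂) (Φ := Φ) (γ := γbar)
        (β₀ := β₀bar) (β₁ := β₁bar) (β₀' := β₀hat (N k) ω) (β₁' := β₁hat (N k) ω)
        hr (hz01 i) hk
    refine (mul_le_mul_of_nonneg_left h1 (by positivity)).trans_eq ?_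
    -- The factor `q k ^ 2` enters the square of the summed parameter errors, so each error is
    -- scaled by `n^{1/4}`.
    rw [norm_smul, norm_smul, norm_smul, Real.norm_of_nonneg (hq0 k)]
    simp only [Function.comp, hK]
    ring
  have hsum := hlin.add hrem
  rw [add_zero] at hsum
  refine hsum.congr fun k => ?_
  change _ = Real.sqrt (N k) * (empMean (N k) z _ - empMean (N k) z _)
  rw [hq2]
  ring

end Asymptotics

end RelErr

end

theorem theorem1 {d m : ℕ}
    -- the super-population
    (pop : Measure (RelErr.PopUnit d)) [IsProbabilityMeasure pop]
    (h_unconf : RelErr.Unconfounded pop)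
    (hy0 : Integrable RelErr.PopUnit.y0 pop) (hy1 : Integrable RelErr.PopUnit.y1 pop)
    -- the candidate CATE estimators, of finite absolute error
    (t₁ t₂ : RelErr.Vec d → ℝ) (ht₁ : Measurable t₁) (ht₂ : Measurable t₂)
    (h_abs₁ : Integrable
      (fun u => (t₁ (RelErr.PopUnit.cov u) - RelErr.cate pop u) ^ 2) pop)
    (h_abs₂ : Integrable
      (fun u => (t₂ (RelErr.PopUnit.cov u) - RelErr.cate pop u) ^ 2) pop)
    -- the representation; the logistic model is correctly specified
    (Φ : RelErr.Vec d → RelErr.Vec m) (hΦ : Measurable Φ)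
    (hΦ_int : Integrable (fun u => Φ (RelErr.PopUnit.cov u)) pop)
    (h_ps : RelErr.PSCorrect pop Φ)
    -- the i.i.d. test sample
    {Ω : Type*} [MeasurableSpace Ω] (P : Measure Ω) [IsProbabilityMeasure P]
    (U : ℕ → Ω → RelErr.PopUnit d)
    (hU_law : ∀ i, HasLaw (U i) pop P) (hU_indep : iIndepFun U P)
    -- the nuisance estimators, from the balance constraints and the weighted least-squares loss
    (c : ℝ) (hc : 0 ≤ c)
    (γhat β₀hat β₁hat : ℕ → Ω → RelErr.Vec m)
    (hγ_meas : ∀ n, AEMeasurable (γhat n) P)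
    (hβ₀_meas : ∀ n, AEMeasurable (β₀hat n) P)
    (hβ₁_meas : ∀ n, AEMeasurable (β₁hat n) P)
    (h_bal : RelErr.SolvesBalance P t₁ t₂ Φ c
      (fun ω i => RelErr.PopUnit.obs (U i ω)) γhat)
    (h_wls : RelErr.SolvesWLS P t₁ t₂ Φ
      (fun ω i => RelErr.PopUnit.obs (U i ω)) γhat β₀hat β₁hat)
    -- their probability limits and rates of convergence
    (γbar β₀bar β₁bar : RelErr.Vec m)
    (hγ_rate : RelErr.FasterThanQuarterRate P γhat γbar)
    (hβ₀_rate : RelErr.FasterThanQuarterRate P β₀hat β₀bar)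
    (hβ₁_rate : RelErr.FasterThanQuarterRate P β₁hat β₁bar)
    -- moment conditions
    (h_var : MemLp
      (fun u => RelErr.phiModel t₁ t₂ Φ γbar β₀bar β₁bar (RelErr.PopUnit.obs u)) 2 pop)
    (h_env : ∃ r : ℝ, 0 < r ∧
      MemLp (fun u => RelErr.envelope t₁ t₂ Φ γbar r (RelErr.PopUnit.obs u)) 2 pop) :
    TendstoInDistribution
      (fun (n : ℕ) ω => Real.sqrt n *
        (RelErr.relErrorEst t₁ t₂ Φ n (fun i => RelErr.PopUnit.obs (U i ω))
          (γhat n ω) (β₀hat n ω) (β₁hat n ω) - RelErr.relError pop t₁ t₂))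
      atTop (id : ℝ → ℝ) (fun _ => P)
      (gaussianReal 0 (Real.toNNReal
        (variance (fun u => RelErr.phiModel t₁ t₂ Φ γbar β₀bar β₁bar
          (RelErr.PopUnit.obs u)) pop))) := by
  obtain ⟨r, hr, henv⟩ := h_env
  obtain ⟨hps, hts, hcs⟩ := RelErr.nuisance_limits h_unconf ht₁ ht₂ hΦ hΦ_int h_ps hU_law hU_indep
    hc h_bal h_wls hγ_rate hβ₀_rate hβ₁_rate hr henv
  have hmean := RelErr.integral_phiModel_eq_relError h_unconf hΦ ht₁ ht₂ hy0 hy1 h_abs₁ h_abs₂ hps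
    β₀bar β₁bar (h_var.integrable one_le_two) hr henv
  have hphi : Measurable fun u : RelErr.PopUnit d =>
      RelErr.phiModel t₁ t₂ Φ γbar β₀bar β₁bar (RelErr.PopUnit.obs u) :=
    RelErr.measurable_phiModel ht₁ ht₂ hΦ measurable_const measurable_const measurable_const
      RelErr.measurable_obs
  have hclt := RelErr.tendstoInDistribution_sqrt_mul_mean_sub hU_law hU_indep hphi h_var
  rw [hmean] at hclt
  have hrem := RelErr.tendstoInMeasure_sqrt_mul_relErrorEst_sub h_unconf ht₁ ht₂ hΦ hU_law hU_indep
    hγ_meas hβ₀_meas hβ₁_meas hγ_rate hβ₀_rate hβ₁_rate hr henv hps hts hcs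
  -- Slutsky: the statistic at the limit parameters is asymptotically normal, and the difference is
  -- negligible.
  refine tendstoInDistribution_of_tendstoInMeasure_sub _ _ hclt
    (hrem.congr_left fun n => ae_of_all _ fun ω => ?_) fun n =>
      ((RelErr.aemeasurable_relErrorEst ht₁ ht₂ hΦ hU_law (hγ_meas n) (hβ₀_meas n) (hβ₁_meas n)
        n).sub_const _).const_mul _
  simp only [Pi.sub_apply, ← mul_sub, sub_sub_sub_cancel_right]
  rfl
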